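/- Let $\chi<0$ and let $Y$ be a simply connected, locally compact, complete, geodesic metric space of curvature $\le\chi$; that is, every point of $Y$ has a neighborhood $V$ such that every geodesic triangle contained in $V$ satisfies the $CAT(\chi)$ inequality: the distance between any two points of the triangle is at most the distance between the corresponding points of a comparison triangle (a triangle with the same side lengths) in the hyperbolic plane of constant curvature $\chi$. Then $Y$ satisfies condition (C) (it has convergent geodesics): for any two geodesic rays $g_1,g_2$ in $Y$ (isometric maps $[0,\infty)\to Y$), or any two geodesics (isometric maps $\mathbb{R}\to Y$), that are asymptotic, i.e. for which $d\bigl(g_1(t),g_2(t)\bigr)$ is bounded for $t\ge 0$, there exists a real number $c$ such that $$\lim_{t\to\infty} d\bigl(g_1(t),g_2(t+c)\bigr)=0.$$ -/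

import Mathlib

open Set Filter Topology

namespace GeodesicSpaces

/-- `γ`, restricted to `[0, dist x y]`, is a geodesic segment from `x` to `y` parametrised by
arc length, i.e. an isometric map of that interval with endpoints `x` and `y`.
The values of `γ` outside the interval are irrelevant. -/
def IsGeodesicSegment {Y : Type*} [MetricSpace Y] (γ : ℝ → Y) (x y : Y) : Prop :=
  γ 0 = x ∧ γ (dist x y) = y ∧
    ∀ s ∈ Icc 0 (dist x y), ∀ t ∈ Icc 0 (dist x y), dist (γ s) (γ t) = |s - t|

/-- A geodesic metric space: any two points are joined by a geodesic segment. -/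
def IsGeodesicMetricSpace (Y : Type*) [MetricSpace Y] : Prop :=
  ∀ x y : Y, ∃ γ : ℝ → Y, IsGeodesicSegment γ x y

/-- The distance of the model plane of constant curvature `χ < 0`: the hyperbolic plane
(the upper half-plane with its metric of curvature `-1`) rescaled by the factor `1 / √(-χ)`. -/
noncomputable def modelDist (χ : ℝ) (p q : UpperHalfPlane) : ℝ :=
  dist p q / √(-χ)

/-- A geodesic triangle with vertices `v 0, v 1, v 2`; the side `σ i` is a geodesic segment from
`v i` to `v (i + 1)`, the indices being taken modulo `3`. -/
def IsGeodesicTriangle {Y : Type*} [MetricSpace Y] (v : Fin 3 → Y) (σ : Fin 3 → ℝ → Y) : Prop :=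
  ∀ i, IsGeodesicSegment (σ i) (v i) (v (i + 1))

/-- `w 0, w 1, w 2` are the vertices of a comparison triangle, in the model plane of curvature
`χ`, for a triangle with vertices `v 0, v 1, v 2`. -/
def IsComparisonTriangle {Y : Type*} [MetricSpace Y] (χ : ℝ) (v : Fin 3 → Y)
    (w : Fin 3 → UpperHalfPlane) : Prop :=
  ∀ i j, modelDist χ (w i) (w j) = dist (v i) (v j)

/-- `p'` is the comparison point of `p`, for a point `p` on a geodesic segment from `x` to `y` and
a segment from `x'` to `y'` of the same length in the model plane of curvature `χ`. -/
def IsComparisonPoint {Y : Type*} [MetricSpace Y] (χ : ℝ) (x y p : Y)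
    (x' y' p' : UpperHalfPlane) : Prop :=
  modelDist χ x' p' = dist x p ∧ modelDist χ p' y' = dist p y

/-- The `CAT(χ)` inequality (`χ < 0`) for the geodesic triangle with vertices `v` and sides `σ`:
any two points of the triangle, on whatever sides they lie, are at most as far apart as their
comparison points in a comparison triangle in the model plane of curvature `χ`. -/
def SatisfiesCAT {Y : Type*} [MetricSpace Y] (χ : ℝ) (v : Fin 3 → Y) (σ : Fin 3 → ℝ → Y) : Prop :=
  ∀ w : Fin 3 → UpperHalfPlane, IsComparisonTriangle χ v w →
    ∀ i j : Fin 3, ∀ s ∈ Icc 0 (dist (v i) (v (i + 1))), ∀ t ∈ Icc 0 (dist (v j) (v (j + 1))),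
      ∀ p' q' : UpperHalfPlane,
        IsComparisonPoint χ (v i) (v (i + 1)) (σ i s) (w i) (w (i + 1)) p' →
        IsComparisonPoint χ (v j) (v (j + 1)) (σ j t) (w j) (w (j + 1)) q' →
        dist (σ i s) (σ j t) ≤ modelDist χ p' q'

/-- Curvature at most `χ`, for `χ < 0`: every point has a neighbourhood `V` such that every
geodesic triangle contained in `V` satisfies the `CAT(χ)` inequality. (There is no bound on the
perimeter of the triangles when `χ < 0`.) -/
def CurvatureLE (Y : Type*) [MetricSpace Y] (χ : ℝ) : Prop :=
  ∀ y : Y, ∃ V ∈ 𝓝 y, ∀ (v : Fin 3 → Y) (σ : Fin 3 → ℝ → Y), IsGeodesicTriangle v σ →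
    (∀ i, ∀ s ∈ Icc 0 (dist (v i) (v (i + 1))), σ i s ∈ V) → SatisfiesCAT χ v σ

/-- A geodesic ray: `g` is isometric on `[0, ∞)`. The values of `g` at negative reals are
irrelevant. -/
def IsGeodesicRay {Y : Type*} [MetricSpace Y] (g : ℝ → Y) : Prop :=
  ∀ s ∈ Ici (0 : ℝ), ∀ t ∈ Ici (0 : ℝ), dist (g s) (g t) = |s - t|

/-- Two rays (or geodesics) are asymptotic: their distance is bounded for positive times. -/
def Asymptotic {Y : Type*} [MetricSpace Y] (g₁ g₂ : ℝ → Y) : Prop :=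
  ∃ M : ℝ, ∀ t ∈ Ici (0 : ℝ), dist (g₁ t) (g₂ t) ≤ M

/-- Condition (C), convergent geodesics: for any two asymptotic geodesic rays, and for any two
asymptotic geodesics (isometric maps of the whole line), there is a real number `c` such that
`dist (g₁ t) (g₂ (t + c))` tends to `0` as `t` tends to infinity. -/
def HasConvergentGeodesics (Y : Type*) [MetricSpace Y] : Prop :=
  (∀ g₁ g₂ : ℝ → Y, IsGeodesicRay g₁ → IsGeodesicRay g₂ → Asymptotic g₁ g₂ →
    ∃ c : ℝ, Tendsto (fun t : ℝ => dist (g₁ t) (g₂ (t + c))) atTop (𝓝 0)) ∧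
  (∀ g₁ g₂ : ℝ → Y, Isometry g₁ → Isometry g₂ → Asymptotic g₁ g₂ →
    ∃ c : ℝ, Tendsto (fun t : ℝ => dist (g₁ t) (g₂ (t + c))) atTop (𝓝 0))

end GeodesicSpaces

/-!
Write `k = √(-χ)`. The proof uses no angles: the curvature bound enters only through the inequality
`2 cosh (k d(p, m)) cosh (k d(x, y) / 2) ≤ cosh (k d(p, x)) + cosh (k d(p, y))` for a small triangle
`p, x, y` and the midpoint `m` of `x, y`. This is `cosh_dist_mid_le`, the `CAT(χ)` inequality between
a vertex and the midpoint of the opposite side; the right-hand side comes from an explicit comparison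
triangle in the upper half-plane. By the Hopf–Rinow theorem (`IsGeodesicMetricSpace.properSpace`)
closed balls are compact, so it holds at a uniform scale on every ball (`exists_midpointCAT`).

*Global convexity* (`hasConvexMetric`). The midpoint inequality implies that the metric is locally
convex: midpoints of opposite sides of a small quadrilateral are at most as far apart as the mean of
the other two sides. Two geodesic segments, together with segments joining their endpoints, bound
a square, as the space is simply connected. Replace the square by a fine grid, and in every row
of the grid replace each interior point by the midpoint of its neighbours, again and again. The
distance of consecutive rows is a subsolution of the discrete heat equation, so it becomes at most
the linear interpolation of its boundary values; the first and the last row are geodesics and do not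
move (`dist_le_of_grid`). Adding up over the rows bounds the distance of the two given segments. In
order that the scale of local convexity is known in advance, the sum of the distances of consecutive
rows has to be bounded independently of the grid; so a fixed coarse family of rows is refined only
by inserting midpoints (`exists_refinement`).

*Exponential contraction* (`dist_le_exp_mul_dist`). Let two geodesics issue from `b`, let `w_i` be
the distance of their points at distance `i δ` from `b`, and `S_i = cosh (k w_i) - 1`. If the `w_i`
are small then `cosh (k δ) S_i ≤ (S_(i-1) + S_(i+1)) / 2` (`MidpointCAT.cosh_mul_le`): corresponding
points are equidistant from `b`, so the diagonals of the quadrilaterals are at least `2 δ` long and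
the displacement of one geodesic against the other is transverse. Comparison with `exp (k r)`
shows that `w` decays exponentially towards `b`. A fan of such thin triangles gives the same, up to a
constant, for the geodesics from `b` to any two points `x` and `y`.

*Rays.* For asymptotic rays `g₁`, `g₂` the contraction is applied to the geodesics from `b = g₁ T`
to `g₁ 0` and `g₂ 0`. As `T` tends to infinity the second one converges to `g₂` by global convexity,
and the difference of the lengths of the two has a limit, which is the shift `c`
(`dist_ray_ray_le`).
-/

namespace GeodesicSpaces

/-! ### Comparison triangles in the upper half-plane -/

section

open Real in
theorem cosh_dist_mk_imaginary (x y e : ℝ) (hy : 0 < y) (he : 0 < e) :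
    cosh (dist (UpperHalfPlane.mk ⟨x, y⟩ hy) (UpperHalfPlane.mk ⟨0, e⟩ he)) =
      (x ^ 2 + y ^ 2 + e ^ 2) / (2 * y * e) := by
  rw [UpperHalfPlane.cosh_dist, Complex.dist_eq_re_im, Real.sq_sqrt (by positivity)]
  simp only [UpperHalfPlane.im]
  field_simp
  ring

open Real in
theorem dist_eq_of_cosh {d α : ℝ} (hd : 0 ≤ d) (hα : 0 ≤ α) (h : cosh d = cosh α) : d = α := by
  have h1 := (cosh_le_cosh (x := d) (y := α)).1 h.le
  have h2 := (cosh_le_cosh (x := α) (y := d)).1 h.ge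
  rw [abs_of_nonneg hd, abs_of_nonneg hα] at h1 h2
  linarith

open Real in
/-- A hyperbolic triangle with sides `2 h`, `α`, `β` and the midpoint of its first side. That side
lies on the imaginary axis, symmetrically about `i`; the third vertex `x + y i` is found from
`U = (x ^ 2 + y ^ 2) / y` and `V = 1 / y`, in which the two distance conditions are linear. -/
theorem exists_comparison_triangle {α β h : ℝ} (hh : 0 < h) (hα : 0 ≤ α) (hβ : 0 ≤ β)
    (h1 : |α - β| ≤ 2 * h) (h2 : 2 * h ≤ α + β) :
    ∃ w₀ w₁ w₂ m : UpperHalfPlane, dist w₀ w₁ = 2 * h ∧ dist w₂ w₀ = α ∧ dist w₂ w₁ = β ∧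
      dist w₀ m = h ∧ dist m w₁ = h ∧
      2 * cosh (dist w₂ m) * cosh h = cosh α + cosh β := by
  have hs : 0 < sinh (2 * h) := sinh_pos_iff.2 (by linarith)
  set E := exp h with hE
  have hEpos : 0 < E := exp_pos h
  have hEi : exp (-h) = E⁻¹ := exp_neg h
  have hsE : 2 * sinh (2 * h) = E ^ 2 - (E⁻¹) ^ 2 := by
    rw [← hEi, sinh_eq, hE, ← exp_nat_mul, ← exp_nat_mul]; push_cast; ring_nf
  have hcE : 2 * cosh h = E + E⁻¹ := by
    rw [← hEi, cosh_eq, hE]; ring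
  have hc2E : 2 * cosh (2 * h) = E ^ 2 + (E⁻¹) ^ 2 := by
    rw [← hEi, cosh_eq, hE, ← exp_nat_mul, ← exp_nat_mul]; push_cast; ring_nf
  set U := (cosh α * E - cosh β * E⁻¹) / sinh (2 * h) with hU
  set V := (cosh β * E - cosh α * E⁻¹) / sinh (2 * h) with hV
  have hEE : E * E⁻¹ = 1 := mul_inv_cancel₀ hEpos.ne'
  -- the Gram determinant of the three points is nonnegative by the triangle inequality
  have hUV : 1 ≤ U * V := by
    have e1 : U * V * sinh (2 * h) ^ 2 =
        (cosh α * E - cosh β * E⁻¹) * (cosh β * E - cosh α * E⁻¹) := by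
      rw [hU, hV]; field_simp
    have e2 : (cosh α * E - cosh β * E⁻¹) * (cosh β * E - cosh α * E⁻¹) =
        cosh α * cosh β * (2 * cosh (2 * h)) - cosh α ^ 2 - cosh β ^ 2 := by
      rw [hc2E]; linear_combination (-(cosh α ^ 2) - cosh β ^ 2) * hEE
    have e3 : 0 ≤ (cosh (α + β) - cosh (2 * h)) * (cosh (2 * h) - cosh (α - β)) := by
      apply mul_nonneg <;> rw [sub_nonneg, cosh_le_cosh]
      · rwa [abs_of_pos (by linarith), abs_of_nonneg (by linarith)]
      · rwa [abs_of_pos (show 0 < 2 * h by linarith)]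
    rw [cosh_add, cosh_sub] at e3
    have a1 := cosh_sq α
    have a2 := cosh_sq β
    have a3 := cosh_sq (2 * h)
    have e4 : sinh (2 * h) ^ 2 ≤ U * V * sinh (2 * h) ^ 2 := by
      rw [e1, e2]
      have : sinh α ^ 2 * sinh β ^ 2 = (cosh α ^ 2 - 1) * (cosh β ^ 2 - 1) := by rw [a1, a2]; ring
      nlinarith
    exact le_of_mul_le_mul_right (by simpa using e4) (pow_pos hs 2)
  have hUVsum : (U + V) * (2 * cosh h) = 2 * (cosh α + cosh β) := by
    have hs' : 2 * sinh (2 * h) = (E - E⁻¹) * (2 * cosh h) := by rw [hsE, hcE]; ring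
    have : (U + V) * sinh (2 * h) = (cosh α + cosh β) * (E - E⁻¹) := by
      rw [hU, hV]; field_simp; ring
    have hne : E - E⁻¹ ≠ 0 := by
      intro h0; rw [h0] at hs'; linarith
    apply mul_right_cancel₀ hne
    linear_combination 2 * this - (U + V) * hs'
  have hVpos : 0 < V := by
    by_contra hcon
    push Not at hcon
    have hUneg : U < 0 := by
      by_contra hU0
      push Not at hU0
      nlinarith [mul_nonneg hU0 (neg_nonneg.2 hcon)]
    nlinarith [cosh_pos h, cosh_pos α, cosh_pos β]
  have hα' : U * E + V * E⁻¹ = 2 * cosh α := by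
    rw [hU, hV]; field_simp
    have := hsE
    field_simp at this
    linear_combination (-cosh α) * this
  have hβ' : U * E⁻¹ + V * E = 2 * cosh β := by
    rw [hU, hV]; field_simp
    have := hsE
    field_simp at this
    linear_combination (-cosh β) * this
  have hy : 0 < V⁻¹ := inv_pos.2 hVpos
  set x := √(U / V - (V⁻¹) ^ 2) with hx
  have hx2 : x ^ 2 = U / V - (V⁻¹) ^ 2 := by
    apply Real.sq_sqrt
    rw [sub_nonneg]
    have : (V⁻¹) ^ 2 * (V ^ 2) = 1 := by field_simp
    have h3 : U / V * V ^ 2 = U * V := by field_simp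
    exact le_of_mul_le_mul_right (by rw [this, h3]; exact hUV) (pow_pos hVpos 2)
  have key : ∀ e (he : 0 < e), cosh (dist (UpperHalfPlane.mk ⟨x, V⁻¹⟩ hy)
      (UpperHalfPlane.mk ⟨0, e⟩ he)) = (U * e⁻¹ + V * e) / 2 := by
    intro e he
    rw [cosh_dist_mk_imaginary, hx2]
    field_simp
    ring
  have hEi' : 0 < E⁻¹ := inv_pos.2 hEpos
  have vert : ∀ e f (he : 0 < e) (hf : 0 < f), dist (UpperHalfPlane.mk ⟨0, e⟩ he)
      (UpperHalfPlane.mk ⟨0, f⟩ hf) = |log e - log f| := by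
    intro e f he hf
    rw [UpperHalfPlane.dist_of_re_eq (by simp [UpperHalfPlane.re]), Real.dist_eq]
    simp [UpperHalfPlane.im]
  have hlE : log E = h := log_exp h
  have hlEi : log E⁻¹ = -h := by rw [log_inv, hlE]
  refine ⟨.mk ⟨0, E⁻¹⟩ hEi', .mk ⟨0, E⟩ hEpos, .mk ⟨x, V⁻¹⟩ hy, .mk ⟨0, 1⟩ one_pos,
    ?_, ?_, ?_, ?_, ?_, ?_⟩
  · rw [vert, hlE, hlEi, abs_of_neg (by linarith)]; ring
  · apply dist_eq_of_cosh dist_nonneg hα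
    rw [key, inv_inv, hα']; ring
  · apply dist_eq_of_cosh dist_nonneg hβ
    rw [key, hβ']; ring
  · rw [vert, hlEi, log_one, abs_of_neg (by linarith)]; ring
  · rw [vert, hlE, log_one, abs_of_neg (by linarith)]; ring
  · rw [key]; linear_combination hUVsum / 2

end

/-! ### Midpoints and the local curvature inequality -/

section

variable {Y : Type*} [MetricSpace Y]

/-- `m` is a metric midpoint of `x` and `y`. -/
def IsMid (m x y : Y) : Prop :=
  dist x m = dist x y / 2 ∧ dist m y = dist x y / 2

theorem IsMid.symm {m x y : Y} (h : IsMid m x y) : IsMid m y x := by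
  refine ⟨?_, ?_⟩
  · rw [dist_comm y m, dist_comm y x, h.2]
  · rw [dist_comm m x, dist_comm y x, h.1]

theorem IsGeodesicSegment.reverse {γ : ℝ → Y} {x y : Y} (h : IsGeodesicSegment γ x y) :
    IsGeodesicSegment (fun t => γ (dist x y - t)) y x := by
  obtain ⟨h0, h1, h2⟩ := h
  refine ⟨by simpa using h1, by simpa [dist_comm y x] using h0, ?_⟩
  intro s hs t ht
  rw [dist_comm y x] at hs ht
  rw [h2 _ ⟨by linarith [hs.2], by linarith [hs.1]⟩ _ ⟨by linarith [ht.2], by linarith [ht.1]⟩,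
    ← abs_neg]
  congr 1; ring

theorem IsGeodesicSegment.dist_left {γ : ℝ → Y} {x y : Y} (h : IsGeodesicSegment γ x y) {t : ℝ}
    (ht : t ∈ Icc 0 (dist x y)) : dist x (γ t) = t := by
  have := h.2.2 0 ⟨le_rfl, dist_nonneg⟩ t ht
  rwa [h.1, zero_sub, abs_neg, abs_of_nonneg ht.1] at this

theorem IsGeodesicSegment.dist_right {γ : ℝ → Y} {x y : Y} (h : IsGeodesicSegment γ x y) {t : ℝ}
    (ht : t ∈ Icc 0 (dist x y)) : dist (γ t) y = dist x y - t := by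
  have := h.2.2 t ht (dist x y) ⟨dist_nonneg, le_rfl⟩
  rwa [h.2.1, abs_sub_comm, abs_of_nonneg (by linarith [ht.2])] at this

/-- Two geodesic segments meeting at a midpoint of the endpoints concatenate to a segment. -/
theorem exists_segment_through_mid (hgeod : IsGeodesicMetricSpace Y) {m x y : Y}
    (hm : IsMid m x y) : ∃ γ : ℝ → Y, IsGeodesicSegment γ x y ∧ γ (dist x y / 2) = m := by
  obtain ⟨γ₁, h₁⟩ := hgeod x m
  obtain ⟨γ₂, h₂⟩ := hgeod m y
  set d := dist x y with hd
  have hd0 : 0 ≤ d := dist_nonneg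
  set γ : ℝ → Y := fun t => if t ≤ d / 2 then γ₁ t else γ₂ (t - d / 2) with hγ
  have e1 : γ (d / 2) = m := by
    simp only [hγ, le_refl, if_true]
    rw [← hm.1]; exact h₁.2.1
  have cross : ∀ s t, 0 ≤ s → s ≤ d / 2 → d / 2 < t → t ≤ d → dist (γ s) (γ t) = |s - t| := by
    intro s t hs0 hs ht ht1
    have g1 : γ s = γ₁ s := by simp [hγ, hs]
    have g2 : γ t = γ₂ (t - d / 2) := by simp [hγ, not_le.2 ht]
    have hsI : s ∈ Icc 0 (dist x m) := ⟨hs0, by rw [hm.1]; exact hs⟩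
    have htI : t - d / 2 ∈ Icc 0 (dist m y) := ⟨by linarith, by rw [hm.2]; linarith⟩
    have a1 := h₁.dist_left hsI
    have a2 := h₁.dist_right hsI
    have b1 := h₂.dist_left htI
    have b2 := h₂.dist_right htI
    rw [hm.1] at a2
    rw [hm.2] at b2
    rw [g1, g2, abs_of_neg (by linarith)]
    have t1 := dist_triangle (γ₁ s) m (γ₂ (t - d / 2))
    have t2 := dist_triangle4 x (γ₁ s) (γ₂ (t - d / 2)) y
    apply le_antisymm <;> linarith
  refine ⟨γ, ⟨?_, ?_, ?_⟩, e1⟩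
  · simp only [hγ, show (0 : ℝ) ≤ d / 2 by linarith, if_true]; exact h₁.1
  · rcases hd0.eq_or_lt with h0 | h0
    · have hγd : γ d = m := by rw [show d = d / 2 by linarith, e1]
      rw [← hd, hγd]
      have : dist m y = 0 := by rw [hm.2]; linarith
      exact dist_eq_zero.1 this
    · have hγd : γ d = γ₂ (d - d / 2) := if_neg (by linarith)
      rw [← hd, hγd, show d - d / 2 = dist m y by rw [hm.2]; linarith]
      exact h₂.2.1
  · intro s hs t ht
    rcases le_or_gt s (d / 2) with hs1 | hs1 <;> rcases le_or_gt t (d / 2) with ht1 | ht1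
    · simp only [hγ, hs1, ht1, if_true]
      exact h₁.2.2 s ⟨hs.1, by rw [hm.1]; exact hs1⟩ t ⟨ht.1, by rw [hm.1]; exact ht1⟩
    · exact cross s t hs.1 hs1 ht1 ht.2
    · rw [dist_comm, abs_sub_comm]; exact cross t s ht.1 ht1 hs1 hs.2
    · simp only [hγ, not_le.2 hs1, not_le.2 ht1, if_false]
      rw [h₂.2.2 _ ⟨by linarith, by rw [hm.2]; linarith [hs.2]⟩ _
        ⟨by linarith, by rw [hm.2]; linarith [ht.2]⟩]
      congr 1; ring

theorem IsGeodesicSegment.isMid {γ : ℝ → Y} {x y : Y} (h : IsGeodesicSegment γ x y) :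
    IsMid (γ (dist x y / 2)) x y := by
  have h0 : 0 ≤ dist x y := dist_nonneg
  have hI : dist x y / 2 ∈ Icc 0 (dist x y) := ⟨by linarith, by linarith⟩
  exact ⟨h.dist_left hI, by rw [h.dist_right hI]; ring⟩

theorem exists_isMid (hgeod : IsGeodesicMetricSpace Y) (x y : Y) : ∃ m, IsMid m x y := by
  obtain ⟨γ, h⟩ := hgeod x y
  exact ⟨_, h.isMid⟩

open Real in
/-- The `CAT(χ)` inequality between a vertex and the midpoint of the opposite side, with the
comparison distance evaluated by hyperbolic trigonometry. -/
theorem cosh_dist_mid_le (hgeod : IsGeodesicMetricSpace Y) {χ : ℝ} (hχ : χ < 0) {V : Set Y}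
    (hV : ∀ (v : Fin 3 → Y) (σ : Fin 3 → ℝ → Y), IsGeodesicTriangle v σ →
      (∀ i, ∀ s ∈ Icc 0 (dist (v i) (v (i + 1))), σ i s ∈ V) → SatisfiesCAT χ v σ)
    {p x y m : Y} {r : ℝ} (hr : Metric.closedBall p (3 * r) ⊆ V) (hx : dist p x ≤ r)
    (hy : dist p y ≤ r) (hm : IsMid m x y) :
    2 * cosh (√(-χ) * dist p m) * cosh (√(-χ) * (dist x y / 2)) ≤
      cosh (√(-χ) * dist p x) + cosh (√(-χ) * dist p y) := by
  have hk : 0 < √(-χ) := Real.sqrt_pos.2 (by linarith)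
  set k := √(-χ) with hkdef
  have md : ∀ a b, modelDist χ a b = dist a b / k := fun _ _ => rfl
  rcases eq_or_ne x y with rfl | hxy
  · have : dist x m = 0 := by rw [hm.1]; simp
    have : x = m := dist_eq_zero.1 this
    subst this
    simp; linarith
  have hd : 0 < dist x y := dist_pos.2 hxy
  have hdr : dist x y ≤ 2 * r := by
    have := dist_triangle_left x y p; linarith
  obtain ⟨σ₀, s₀, hσ₀⟩ := exists_segment_through_mid hgeod hm
  obtain ⟨σ₁, s₁⟩ := hgeod y p
  obtain ⟨σ₂, s₂⟩ := hgeod p x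
  have tri : IsGeodesicTriangle ![x, y, p] ![σ₀, σ₁, σ₂] := by
    intro i
    fin_cases i
    · exact s₀
    · exact s₁
    · exact s₂
  have hin : ∀ i, ∀ s ∈ Icc 0 (dist ((![x, y, p] : Fin 3 → Y) i) (![x, y, p] (i + 1))),
      (![σ₀, σ₁, σ₂] : Fin 3 → ℝ → Y) i s ∈ V := by
    intro i s hs
    apply hr
    rw [Metric.mem_closedBall, dist_comm]
    fin_cases i
    · change s ∈ Icc 0 (dist x y) at hs
      change dist p (σ₀ s) ≤ _
      have := s₀.dist_left hs
      linarith [dist_triangle p x (σ₀ s), hs.2]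
    · change s ∈ Icc 0 (dist y p) at hs
      change dist p (σ₁ s) ≤ _
      have := s₁.dist_right hs
      rw [dist_comm, this]
      linarith [hs.1, dist_comm y p, dist_nonneg (x := p) (y := y)]
    · change s ∈ Icc 0 (dist p x) at hs
      change dist p (σ₂ s) ≤ _
      rw [s₂.dist_left hs]
      linarith [hs.2, dist_nonneg (x := p) (y := x)]
  obtain ⟨w₀, w₁, w₂, n, c₀, c₁, c₂, c₃, c₄, c₅⟩ := exists_comparison_triangle
    (α := k * dist p x) (β := k * dist p y) (h := k * (dist x y / 2)) (by positivity)
    (by positivity) (by positivity)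
    (by
      rw [← mul_sub, abs_mul, abs_of_pos hk]
      have : |dist p x - dist p y| ≤ dist x y := by
        have := abs_dist_sub_le x y p
        rwa [dist_comm x p, dist_comm y p] at this
      nlinarith)
    (by
      have := dist_triangle_left x y p
      nlinarith)
  have cat := hV _ _ tri hin ![w₀, w₁, w₂]
    (by
      have e1 : modelDist χ w₀ w₁ = dist x y := by rw [md, c₀]; field_simp
      have e2 : modelDist χ w₂ w₀ = dist p x := by rw [md, c₁]; field_simp
      have e3 : modelDist χ w₂ w₁ = dist p y := by rw [md, c₂]; field_simp
      have sym : ∀ a b, modelDist χ a b = modelDist χ b a := fun a b => by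
        rw [md, md, dist_comm]
      have slf : ∀ a, modelDist χ a a = 0 := fun a => by simp [modelDist]
      intro i j
      fin_cases i <;> fin_cases j
      · simp [slf]
      · exact e1
      · change modelDist χ w₀ w₂ = dist x p
        rw [sym, e2, dist_comm]
      · change modelDist χ w₁ w₀ = dist y x
        rw [sym, e1, dist_comm]
      · simp [slf]
      · change modelDist χ w₁ w₂ = dist y p
        rw [sym, e3, dist_comm]
      · exact e2
      · exact e3
      · simp [slf])
    0 2 (dist x y / 2) ⟨by linarith, by change _ ≤ dist x y; linarith⟩ 0 ⟨le_rfl, dist_nonneg⟩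
    n w₂
    (by
      change modelDist χ w₀ n = dist x (σ₀ _) ∧ modelDist χ n w₁ = dist (σ₀ _) y
      rw [hσ₀, hm.1, hm.2, md, md, c₃, c₄]
      constructor <;> field_simp)
    (by
      change modelDist χ w₂ w₂ = dist p (σ₂ 0) ∧ modelDist χ w₂ w₀ = dist (σ₂ 0) x
      rw [s₂.1, md, md, c₁]
      constructor
      · simp
      · field_simp)
  change dist (σ₀ (dist x y / 2)) (σ₂ 0) ≤ modelDist χ n w₂ at cat
  rw [hσ₀, s₂.1, md, le_div_iff₀ hk, dist_comm n w₂, dist_comm m p] at cat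
  rw [← c₅]
  apply mul_le_mul_of_nonneg_right _ (cosh_pos _).le
  apply mul_le_mul_of_nonneg_left _ two_pos.le
  rw [cosh_le_cosh, abs_of_nonneg (by positivity), abs_of_nonneg dist_nonneg]
  linarith

open Real in
/-- The midpoint form of the `CAT(-k²)` inequality, for vertices in `K` and adjacent sides of
length at most `ε`. -/
def MidpointCAT (k ε : ℝ) (K : Set Y) : Prop :=
  ∀ p ∈ K, ∀ x y m : Y, dist p x ≤ ε → dist p y ≤ ε → IsMid m x y →
    2 * cosh (k * dist p m) * cosh (k * (dist x y / 2)) ≤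
      cosh (k * dist p x) + cosh (k * dist p y)

/-- Curvature at most `χ` gives the midpoint inequality at a uniform scale on a compact set, by
the Lebesgue number of the cover by the neighbourhoods of the definition. -/
theorem exists_midpointCAT (hgeod : IsGeodesicMetricSpace Y) {χ : ℝ} (hχ : χ < 0)
    (hcurv : CurvatureLE Y χ) {K : Set Y} (hK : IsCompact K) :
    ∃ ε > 0, ε ≤ 1 ∧ MidpointCAT √(-χ) ε K := by
  choose V hVn hV using hcurv
  obtain ⟨δ, hδ, h⟩ := lebesgue_number_lemma_of_metric (c := fun y => interior (V y)) hK
    (fun y => isOpen_interior) (fun y _ => mem_iUnion.2 ⟨y, mem_interior_iff_mem_nhds.2 (hVn y)⟩)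
  refine ⟨min 1 (δ / 4), by positivity, min_le_left _ _, ?_⟩
  intro p hp x y m hx hy hm
  obtain ⟨q, hq⟩ := h p hp
  refine cosh_dist_mid_le hgeod hχ (hV q) (r := δ / 4) ?_ (hx.trans (min_le_right _ _))
    (hy.trans (min_le_right _ _)) hm
  exact (Metric.closedBall_subset_ball (by linarith)).trans (hq.trans interior_subset)

open Real in
theorem le_of_cosh_mul_le {k a b : ℝ} (hk : 0 < k) (ha : 0 ≤ a) (hb : 0 ≤ b)
    (h : cosh (k * a) ≤ cosh (k * b)) : a ≤ b := by
  rw [cosh_le_cosh, abs_of_nonneg (by positivity), abs_of_nonneg (by positivity)] at h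
  exact le_of_mul_le_mul_left h hk

open Real in
theorem MidpointCAT.mid_unique {k ε : ℝ} {K : Set Y} (hk : 0 < k) (h : MidpointCAT k ε K)
    {m m' x y : Y} (hm : IsMid m x y) (hm' : IsMid m' x y) (hK : m' ∈ K)
    (hxy : dist x y ≤ ε) : m' = m := by
  have e1 : dist m' x = dist x y / 2 := by rw [dist_comm]; exact hm'.1
  have h0 : 0 ≤ dist x y := dist_nonneg
  have := h m' hK x y m (by rw [e1]; linarith) (by rw [hm'.2]; linarith) hm
  rw [e1, hm'.2] at this
  have hc := cosh_pos (k * (dist x y / 2))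
  have h1 : cosh (k * dist m' m) ≤ cosh (k * 0) := by
    rw [mul_zero, cosh_zero]
    apply le_of_mul_le_mul_right _ hc
    linarith
  exact dist_le_zero.1 (le_of_cosh_mul_le hk dist_nonneg le_rfl h1)

open Real in
/-- The Gram determinant of three points of the hyperbolic plane has a sign; here for any three
lengths which satisfy the triangle inequalities. -/
theorem cosh_gram_le {a b d : ℝ} (ha : 0 ≤ a) (hb : 0 ≤ b) (hd : 0 ≤ d) (h1 : d ≤ a + b)
    (h2 : |a - b| ≤ d) :
    cosh a ^ 2 + cosh b ^ 2 + cosh d ^ 2 - 1 ≤ 2 * cosh a * cosh b * cosh d := by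
  have e3 : 0 ≤ (cosh (a + b) - cosh d) * (cosh d - cosh (a - b)) := by
    apply mul_nonneg <;> rw [sub_nonneg, cosh_le_cosh]
    · rwa [abs_of_nonneg hd, abs_of_nonneg (by linarith)]
    · rwa [abs_of_nonneg hd]
  rw [cosh_add, cosh_sub] at e3
  have : sinh a ^ 2 * sinh b ^ 2 = (cosh a ^ 2 - 1) * (cosh b ^ 2 - 1) := by
    rw [cosh_sq a, cosh_sq b]; ring
  nlinarith

open Real in
/-- The segment joining the midpoints of two sides of a small triangle is at most half the third
side. The midpoint inequality is applied to `y` and the side `[p, x]`, then to `m` and the side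
`[p, y]`. -/
theorem MidpointCAT.dist_mid_mid_le {k ε : ℝ} {K : Set Y} (hk : 0 < k) (h : MidpointCAT k ε K)
    {p x y m m' : Y} (hm : IsMid m p x) (hm' : IsMid m' p y) (hyK : y ∈ K) (hmK : m ∈ K)
    (hpx : dist p x ≤ ε / 2) (hpy : dist p y ≤ ε / 2) (hxy : dist x y ≤ ε / 2) :
    dist m m' ≤ dist x y / 2 := by
  have h0 : 0 ≤ dist p x := dist_nonneg
  have h0' : 0 ≤ dist p y := dist_nonneg
  have h0'' : 0 ≤ dist x y := dist_nonneg
  have i1 := h y hyK p x m (by rw [dist_comm]; linarith) (by rw [dist_comm]; linarith) hm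
  have e1 : dist m p = dist p x / 2 := by rw [dist_comm]; exact hm.1
  have e2 : dist m y ≤ ε := by
    have := dist_triangle m x y
    rw [hm.2] at this
    linarith
  have i2 := h m hmK p y m' (by rw [e1]; linarith) e2 hm'
  rw [dist_comm y p, dist_comm y x, dist_comm y m] at i1
  rw [e1] at i2
  have i3 := cosh_gram_le (a := k * (dist p x / 2)) (b := k * (dist p y / 2))
    (d := k * (dist x y / 2)) (by positivity) (by positivity) (by positivity)
    (by
      have := dist_triangle_left x y p
      nlinarith)
    (by
      rw [← mul_sub, abs_mul, abs_of_pos hk]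
      have : |dist p x - dist p y| ≤ dist x y := by
        have := abs_dist_sub_le x y p
        rwa [dist_comm x p, dist_comm y p] at this
      rw [show dist p x / 2 - dist p y / 2 = (dist p x - dist p y) / 2 by ring, abs_div, abs_two]
      nlinarith)
  have dbl : ∀ a, cosh (k * a) = 2 * cosh (k * (a / 2)) ^ 2 - 1 := fun a => by
    rw [show k * a = 2 * (k * (a / 2)) by ring, cosh_two_mul, cosh_sq (k * (a / 2))]; ring
  rw [dbl (dist p y), dbl (dist x y)] at i1
  have hX := cosh_pos (k * (dist p x / 2))
  have hY := cosh_pos (k * (dist p y / 2))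
  apply le_of_cosh_mul_le hk dist_nonneg (by positivity)
  apply le_of_mul_le_mul_right _ (mul_pos hX hY)
  nlinarith

/-- Local convexity of the metric: the midpoints of two opposite sides of a small quadrilateral. -/
theorem MidpointCAT.dist_mid_quad_le {k ε : ℝ} {K : Set Y} (hk : 0 < k) (h : MidpointCAT k ε K)
    (hgeod : IsGeodesicMetricSpace Y) {x y x' y' m m' : Y} (hm : IsMid m x y)
    (hm' : IsMid m' x' y') (hxK : x ∈ K) (hyK : y' ∈ K) (hmK : m ∈ K) (hmK' : m' ∈ K)
    (hxy : dist x y ≤ ε / 4) (hxy' : dist x' y' ≤ ε / 4)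
    (hxx : dist x x' ≤ ε / 4) (hyy : dist y y' ≤ ε / 4) :
    dist m m' ≤ (dist x x' + dist y y') / 2 := by
  obtain ⟨n, hn⟩ := exists_isMid hgeod x y'
  have hd : dist x y' ≤ ε / 2 := by
    have := dist_triangle x y y'; linarith
  have a1 := h.dist_mid_mid_le hk hm hn hyK hmK (by linarith [dist_nonneg (x := x) (y := y)]) hd
    (by linarith [dist_nonneg (x := x) (y := y)])
  have a2 := h.dist_mid_mid_le hk hm'.symm hn.symm hxK hmK'
    (by rw [dist_comm]; linarith [dist_nonneg (x := x) (y := y)])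
    (by rw [dist_comm]; linarith) (by rw [dist_comm]; linarith [dist_nonneg (x := x) (y := y)])
  have := dist_triangle_right m m' n
  rw [dist_comm x' x] at a2
  linarith

/-- A complete, locally compact, geodesic space is proper (Hopf–Rinow). -/
theorem IsGeodesicMetricSpace.properSpace [LocallyCompactSpace Y] [CompleteSpace Y]
    (hgeod : IsGeodesicMetricSpace Y) : ProperSpace Y := by
  -- the ball of radius `r + δ` lies in the `δ`-neighbourhood of the ball of radius `r`
  have near : ∀ (o z : Y) (r δ : ℝ), 0 ≤ r → 0 ≤ δ → dist o z ≤ r + δ →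
      ∃ z' ∈ Metric.closedBall o r, dist z z' ≤ δ := by
    intro o z r δ hr hδ hz
    obtain ⟨γ, hγ⟩ := hgeod o z
    have hI : min r (dist o z) ∈ Icc 0 (dist o z) := ⟨le_min hr dist_nonneg, min_le_right _ _⟩
    refine ⟨γ (min r (dist o z)), ?_, ?_⟩
    · rw [Metric.mem_closedBall, dist_comm, hγ.dist_left hI]; exact min_le_left _ _
    · rw [dist_comm, hγ.dist_right hI]
      rcases min_choice r (dist o z) with h | h <;> rw [h] <;> linarith
  constructor
  intro o
  by_contra! hcon
  obtain ⟨r₁, hr₁⟩ := hcon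
  -- the radii of compact balls form an interval, whose supremum belongs to it and can be exceeded
  set A := {r : ℝ | IsCompact (Metric.closedBall o r)} with hA
  have hmono : ∀ r ∈ A, ∀ s ≤ r, s ∈ A := fun r hr s hs =>
    IsCompact.of_isClosed_subset hr Metric.isClosed_closedBall (Metric.closedBall_subset_closedBall hs)
  have hbdd : ∀ r ∈ A, r ≤ r₁ := fun r hr => by
    by_contra! hlt
    exact hr₁ (hmono r hr r₁ hlt.le)
  have h0 : (0 : ℝ) ∈ A := by simp [hA]
  set ρ := sSup A with hρ
  have hρ0 : 0 ≤ ρ := le_csSup ⟨r₁, hbdd⟩ h0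
  have hlt : ∀ r < ρ, r ∈ A := fun r hr => by
    obtain ⟨s, hs, hrs⟩ := exists_lt_of_lt_csSup ⟨0, h0⟩ hr
    exact hmono s hs r hrs.le
  have hρA : ρ ∈ A := by
    refine TotallyBounded.isCompact_of_isClosed ?_ Metric.isClosed_closedBall
    rw [Metric.totallyBounded_iff]
    intro δ hδ
    rcases lt_or_ge (ρ - δ / 2) 0 with hneg | hpos
    · refine ⟨{o}, finite_singleton o, ?_⟩
      intro z hz
      simp only [mem_singleton_iff, iUnion_iUnion_eq_left, Metric.mem_ball]
      have := Metric.mem_closedBall.1 hz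
      linarith
    · obtain ⟨t, ht, htc⟩ := Metric.totallyBounded_iff.1
        (hlt (ρ - δ / 2) (by linarith)).totallyBounded (δ / 2) (by linarith)
      refine ⟨t, ht, ?_⟩
      intro z hz
      obtain ⟨z', hz', hzz'⟩ := near o z (ρ - δ / 2) (δ / 2) hpos (by linarith)
        (by rw [dist_comm]; have := Metric.mem_closedBall.1 hz; linarith)
      have := htc hz'
      simp only [mem_iUnion, Metric.mem_ball] at this ⊢
      obtain ⟨i, hi, hi'⟩ := this
      exact ⟨i, hi, by linarith [dist_triangle z z' i]⟩
  obtain ⟨K', hK', hsub⟩ := exists_compact_superset (show IsCompact (Metric.closedBall o ρ) from hρA)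
  obtain ⟨δ, hδ, hthick⟩ := IsCompact.exists_cthickening_subset_open
    (show IsCompact (Metric.closedBall o ρ) from hρA) isOpen_interior hsub
  have : ρ + δ ∈ A := by
    apply IsCompact.of_isClosed_subset hK' Metric.isClosed_closedBall
    intro z hz
    apply interior_subset
    apply hthick
    obtain ⟨z', hz', hzz'⟩ := near o z ρ δ hρ0 hδ.le (by
      rw [dist_comm]; exact Metric.mem_closedBall.1 hz)
    exact Metric.mem_cthickening_of_dist_le z z' δ _ hz' hzz'
  have := le_csSup ⟨r₁, hbdd⟩ this
  linarith

end

/-! ### Filling a square in a simply connected space -/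

section

variable {Y : Type*} [MetricSpace Y]

/-- The retraction of the line onto the unit interval. -/
def clamp (t : ℝ) : ℝ := max 0 (min t 1)

theorem continuous_clamp : Continuous clamp := by unfold clamp; fun_prop

theorem clamp_mem (t : ℝ) : clamp t ∈ Icc (0 : ℝ) 1 :=
  ⟨le_max_left _ _, max_le zero_le_one (min_le_right _ _)⟩

theorem clamp_of_mem {t : ℝ} (h : t ∈ Icc (0 : ℝ) 1) : clamp t = t := by
  rw [clamp, min_eq_left h.2, max_eq_right h.1]

theorem clamp_of_nonpos {t : ℝ} (h : t ≤ 0) : clamp t = 0 := by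
  rw [clamp, max_eq_left ((min_le_left _ _).trans h)]

theorem clamp_of_one_le {t : ℝ} (h : 1 ≤ t) : clamp t = 1 := by
  rw [clamp, min_eq_right h, max_eq_right zero_le_one]

theorem clamp_clamp (t : ℝ) : clamp (clamp t) = clamp t := clamp_of_mem (clamp_mem t)

theorem clamp_mono : Monotone clamp := fun s t h => by unfold clamp; gcongr

/-- Four continuous curves forming the boundary of a square in a simply connected space extend
to a map of the square, of height `3`. The vertical sides pause outside the middle third. -/
theorem exists_filling [SimplyConnectedSpace Y] {c c' a b : ℝ → Y} (hc : Continuous c)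
    (hc' : Continuous c') (ha : Continuous a) (hb : Continuous b) (hca : c 0 = a 0)
    (hcb : c 1 = b 0) (hca' : c' 0 = a 1) (hcb' : c' 1 = b 1) :
    ∃ H : ℝ × ℝ → Y, Continuous H ∧ (∀ t ∈ Icc (0 : ℝ) 1, H (0, t) = c t) ∧
      (∀ t ∈ Icc (0 : ℝ) 1, H (3, t) = c' t) ∧ (∀ s, H (s, 0) = a (clamp (s - 1))) ∧
      ∀ s, H (s, 1) = b (clamp (s - 1)) := by
  let pc : Path (a 0) (b 0) := ⟨⟨fun t => c t, by fun_prop⟩, by simpa using hca, by simpa using hcb⟩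
  let pb : Path (b 0) (b 1) := ⟨⟨fun t => b t, by fun_prop⟩, by simp, by simp⟩
  let pa : Path (a 0) (a 1) := ⟨⟨fun t => a t, by fun_prop⟩, by simp, by simp⟩
  let pc' : Path (a 1) (b 1) :=
    ⟨⟨fun t => c' t, by fun_prop⟩, by simpa using hca', by simpa using hcb'⟩
  obtain ⟨F⟩ := SimplyConnectedSpace.paths_homotopic (pc.trans pb) (pa.trans pc')
  let K : ℝ × ℝ → Y := fun z => F (projIcc 0 1 zero_le_one z.1, projIcc 0 1 zero_le_one z.2)
  have hK : Continuous K := by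
    apply F.continuous.comp
    exact (continuous_projIcc.comp continuous_fst).prodMk (continuous_projIcc.comp continuous_snd)
  have p0 : projIcc (0 : ℝ) 1 zero_le_one 0 = 0 := projIcc_left _
  have p1 : projIcc (0 : ℝ) 1 zero_le_one 1 = 1 := projIcc_right _
  have K00 : ∀ t ∈ Icc (0 : ℝ) 1, K (0, t / 2) = c t := by
    intro t ht
    have hm : t / 2 ∈ Icc (0 : ℝ) 1 := ⟨by linarith [ht.1], by linarith [ht.2]⟩
    simp only [K, p0, F.apply_zero, projIcc_of_mem zero_le_one hm]
    change (pc.trans pb) _ = _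
    rw [Path.trans_apply, dif_pos (show t / 2 ≤ 1 / 2 by linarith [ht.2])]
    change c (2 * (t / 2)) = _
    congr 1; ring
  have K01 : ∀ t ∈ Icc (0 : ℝ) 1, K (0, (t + 1) / 2) = b t := by
    intro t ht
    have hm : (t + 1) / 2 ∈ Icc (0 : ℝ) 1 := ⟨by linarith [ht.1], by linarith [ht.2]⟩
    rcases ht.1.eq_or_lt with h0 | h0
    · subst h0
      have := K00 1 (by simp)
      rw [zero_add, this, hcb]
    simp only [K, p0, F.apply_zero, projIcc_of_mem zero_le_one hm]
    change (pc.trans pb) _ = _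
    rw [Path.trans_apply, dif_neg (show ¬ (t + 1) / 2 ≤ 1 / 2 by linarith)]
    change b (2 * ((t + 1) / 2) - 1) = _
    congr 1; ring
  have K10 : ∀ t ∈ Icc (0 : ℝ) 1, K (1, t / 2) = a t := by
    intro t ht
    have hm : t / 2 ∈ Icc (0 : ℝ) 1 := ⟨by linarith [ht.1], by linarith [ht.2]⟩
    simp only [K, p1, F.apply_one, projIcc_of_mem zero_le_one hm]
    change (pa.trans pc') _ = _
    rw [Path.trans_apply, dif_pos (show t / 2 ≤ 1 / 2 by linarith [ht.2])]
    change a (2 * (t / 2)) = _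
    congr 1; ring
  have K11 : ∀ t ∈ Icc (0 : ℝ) 1, K (1, (t + 1) / 2) = c' t := by
    intro t ht
    have hm : (t + 1) / 2 ∈ Icc (0 : ℝ) 1 := ⟨by linarith [ht.1], by linarith [ht.2]⟩
    rcases ht.1.eq_or_lt with h0 | h0
    · subst h0
      have := K10 1 (by simp)
      rw [zero_add, this, hca']
    simp only [K, p1, F.apply_one, projIcc_of_mem zero_le_one hm]
    change (pa.trans pc') _ = _
    rw [Path.trans_apply, dif_neg (show ¬ (t + 1) / 2 ≤ 1 / 2 by linarith)]
    change c' (2 * ((t + 1) / 2) - 1) = _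
    congr 1; ring
  have Kl : ∀ u, K (u, 0) = a 0 := fun u => by simp [K]
  have Kr : ∀ u, K (u, 1) = b 1 := fun u => by simp [K]
  -- in the outer thirds only the homotopy parameter moves, in the middle third only the other one
  refine ⟨fun z => K ((1 - z.2) * clamp z.1 + z.2 * clamp (z.1 - 2), (clamp (z.1 - 1) + z.2) / 2),
    ?_, ?_, ?_, ?_, ?_⟩
  · apply hK.comp
    have h0 := continuous_clamp
    fun_prop
  · intro t ht
    simp only
    rw [clamp_of_nonpos le_rfl, clamp_of_nonpos (by norm_num), clamp_of_nonpos (by norm_num)]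
    simpa using K00 t ht
  · intro t ht
    simp only
    rw [clamp_of_one_le (by norm_num), clamp_of_one_le (by norm_num),
      clamp_of_one_le (by norm_num)]
    simpa [add_comm] using K11 t ht
  · intro s
    simp only [sub_zero, one_mul, zero_mul, add_zero]
    rcases le_total s 1 with h | h
    · rw [clamp_of_nonpos (show s - 1 ≤ 0 by linarith), zero_div, Kl]
    · rw [clamp_of_one_le h, K10 _ (clamp_mem _)]
  · intro s
    simp only [sub_self, zero_mul, one_mul, zero_add]
    rcases le_total (s - 1) 1 with h | h
    · rw [clamp_of_nonpos (show s - 2 ≤ 0 by linarith), K01 _ (clamp_mem _)]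
    · rw [clamp_of_one_le h, show ((1 : ℝ) + 1) / 2 = 1 by norm_num, Kr]

theorem IsGeodesicSegment.continuous_clamp {γ : ℝ → Y} {x y : Y} (h : IsGeodesicSegment γ x y) :
    Continuous fun t => γ (dist x y * clamp t) := by
  have h1 : ContinuousOn γ (Icc 0 (dist x y)) := by
    have : LipschitzOnWith 1 γ (Icc 0 (dist x y)) :=
      LipschitzOnWith.of_dist_le_mul fun s hs t ht => by
        rw [h.2.2 s hs t ht, Real.dist_eq]; simp
    exact this.continuousOn
  refine h1.comp_continuous (continuous_const.mul GeodesicSpaces.continuous_clamp) fun t => ?_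
  have := clamp_mem t
  have h0 : 0 ≤ dist x y := dist_nonneg
  exact ⟨mul_nonneg h0 this.1, mul_le_of_le_one_right h0 this.2⟩

theorem IsGeodesicSegment.dist_clamp {γ : ℝ → Y} {x y : Y} (h : IsGeodesicSegment γ x y)
    (s t : ℝ) : dist (γ (dist x y * clamp s)) (γ (dist x y * clamp t)) =
      dist x y * |clamp s - clamp t| := by
  have h0 : 0 ≤ dist x y := dist_nonneg
  have hm : ∀ t, dist x y * clamp t ∈ Icc 0 (dist x y) := fun t =>
    ⟨mul_nonneg h0 (clamp_mem t).1, mul_le_of_le_one_right h0 (clamp_mem t).2⟩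
  rw [h.2.2 _ (hm s) _ (hm t), ← mul_sub, abs_mul, abs_of_nonneg h0]

end

/-! ### The discrete heat flow on polygons -/

section

theorem sum_range_two_mul (f : ℕ → ℝ) (m : ℕ) :
    ∑ j ∈ Finset.range (2 * m), f j = ∑ j ∈ Finset.range m, (f (2 * j) + f (2 * j + 1)) := by
  induction m with
  | zero => simp
  | succ m ih =>
    rw [show 2 * (m + 1) = 2 * m + 1 + 1 by ring, Finset.sum_range_succ, Finset.sum_range_succ, ih,
      Finset.sum_range_succ, add_assoc]

variable {Y : Type*}

/-- One step of the discrete heat flow on the points `x 0, …, x N`: every interior point is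
replaced by the midpoint of its neighbours. -/
def heatStep (mid : Y → Y → Y) (N : ℕ) (x : ℕ → Y) : ℕ → Y
  | 0 => x 0
  | i + 1 => if i + 2 ≤ N then mid (x i) (x (i + 2)) else x (i + 1)

theorem heatStep_interior (mid : Y → Y → Y) {N i : ℕ} (x : ℕ → Y) (h : i + 2 ≤ N) :
    heatStep mid N x (i + 1) = mid (x i) (x (i + 2)) := if_pos h

theorem heatStep_last (mid : Y → Y → Y) (N : ℕ) (x : ℕ → Y) : heatStep mid N x N = x N := by
  cases N with
  | zero => rfl
  | succ n => exact if_neg (by omega)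

variable [MetricSpace Y] {mid : Y → Y → Y} {N : ℕ} {k ε : ℝ} {K : Set Y}

theorem dist_heatStep_left (hmid : ∀ x y, IsMid (mid x y) x y) {x : ℕ → Y} {σ : ℝ}
    (hx : ∀ i < N, dist (x i) (x (i + 1)) ≤ σ) {i : ℕ} (hi : i + 2 ≤ N) :
    dist (x i) (heatStep mid N x (i + 1)) ≤ σ := by
  rw [heatStep_interior mid x hi, (hmid _ _).1]
  linarith [dist_triangle (x i) (x (i + 1)) (x (i + 2)), hx i (by omega), hx (i + 1) (by omega)]

theorem dist_heatStep_right (hmid : ∀ x y, IsMid (mid x y) x y) {x : ℕ → Y} {σ : ℝ}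
    (hx : ∀ i < N, dist (x i) (x (i + 1)) ≤ σ) {i : ℕ} (hi : i + 2 ≤ N) :
    dist (heatStep mid N x (i + 1)) (x (i + 2)) ≤ σ := by
  rw [heatStep_interior mid x hi, (hmid _ _).2]
  linarith [dist_triangle (x i) (x (i + 1)) (x (i + 2)), hx i (by omega), hx (i + 1) (by omega)]

/-- The heat flow does not increase the mesh. -/
theorem dist_heatStep_succ_le (hk : 0 < k) (hgeod : IsGeodesicMetricSpace Y)
    (h : MidpointCAT k ε K) (hmid : ∀ x y, IsMid (mid x y) x y) {x : ℕ → Y}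
    (hx : ∀ i < N, dist (x i) (x (i + 1)) ≤ ε / 8) (hxK : ∀ i ≤ N, x i ∈ K)
    (hfK : ∀ i ≤ N, heatStep mid N x i ∈ K) {i : ℕ} (hi : i < N) :
    dist (heatStep mid N x i) (heatStep mid N x (i + 1)) ≤ ε / 8 := by
  have hε : 0 ≤ ε := by linarith [hx i hi, dist_nonneg (x := x i) (y := x (i + 1))]
  rcases Nat.lt_or_ge (i + 1) N with h1 | h1
  · cases i with
    | zero => exact dist_heatStep_left hmid hx h1
    | succ i =>
      have m1 := hfK (i + 1) (by omega)
      have m2 := hfK (i + 1 + 1) (by omega)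
      rw [heatStep_interior mid x (by omega)] at m1 m2 ⊢
      rw [heatStep_interior mid x (by omega)]
      have e1 := hx i (by omega)
      have e2 := hx (i + 1) (by omega)
      have e3 := hx (i + 2) (by omega)
      have := h.dist_mid_quad_le hk hgeod (hmid (x i) (x (i + 2)))
        (hmid (x (i + 1)) (x (i + 1 + 2))) (hxK i (by omega)) (hxK _ (by omega)) m1 m2
        (by linarith [dist_triangle (x i) (x (i + 1)) (x (i + 2))])
        (by linarith [dist_triangle (x (i + 1)) (x (i + 2)) (x (i + 3))])
        (by linarith) (by linarith)
      linarith
  · obtain rfl : N = i + 1 := by omega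
    rw [heatStep_last]
    cases i with
    | zero => exact hx 0 hi
    | succ i => exact dist_heatStep_right hmid hx le_rfl

/-- The distance of two polygons is a subsolution of the discrete heat equation. -/
theorem dist_heatStep_heatStep_le (hk : 0 < k) (hgeod : IsGeodesicMetricSpace Y)
    (h : MidpointCAT k ε K) (hmid : ∀ x y, IsMid (mid x y) x y) {x x' : ℕ → Y}
    (hx : ∀ i < N, dist (x i) (x (i + 1)) ≤ ε / 8) (hxK : ∀ i ≤ N, x i ∈ K)
    (hfK : ∀ i ≤ N, heatStep mid N x i ∈ K)
    (hx' : ∀ i < N, dist (x' i) (x' (i + 1)) ≤ ε / 8) (hxK' : ∀ i ≤ N, x' i ∈ K)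
    (hfK' : ∀ i ≤ N, heatStep mid N x' i ∈ K)
    (hxx : ∀ i ≤ N, dist (x i) (x' i) ≤ ε / 4) {i : ℕ} (hi : i + 2 ≤ N) :
    dist (heatStep mid N x (i + 1)) (heatStep mid N x' (i + 1)) ≤
      (dist (x i) (x' i) + dist (x (i + 2)) (x' (i + 2))) / 2 := by
  have m1 := hfK (i + 1) (by omega)
  have m2 := hfK' (i + 1) (by omega)
  rw [heatStep_interior mid _ hi] at m1 m2 ⊢
  rw [heatStep_interior mid _ hi]
  exact h.dist_mid_quad_le hk hgeod (hmid _ _) (hmid _ _) (hxK i (by omega)) (hxK' _ (by omega))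
    m1 m2
    (by linarith [dist_triangle (x i) (x (i + 1)) (x (i + 2)), hx i (by omega),
      hx (i + 1) (by omega)])
    (by linarith [dist_triangle (x' i) (x' (i + 1)) (x' (i + 2)), hx' i (by omega),
      hx' (i + 1) (by omega)])
    (hxx i (by omega)) (hxx _ (by omega))

/-- Subdivided geodesics are stationary under the heat flow. -/
theorem heatStep_eq_self (hk : 0 < k) (h : MidpointCAT k ε K)
    (hmid : ∀ x y, IsMid (mid x y) x y) {x : ℕ → Y}
    (hx : ∀ i < N, dist (x i) (x (i + 1)) ≤ ε / 8) (hxK : ∀ i ≤ N, x i ∈ K)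
    (hfix : ∀ i, i + 2 ≤ N → IsMid (x (i + 1)) (x i) (x (i + 2))) {i : ℕ} (hi : i ≤ N) :
    heatStep mid N x i = x i := by
  cases i with
  | zero => rfl
  | succ i =>
    rcases Nat.lt_or_ge (i + 1) N with h1 | h1
    · rw [heatStep_interior mid x h1]
      refine (h.mid_unique hk (hmid _ _) (hfix i h1) (hxK _ hi) ?_).symm
      have := hx i (by omega)
      linarith [dist_triangle (x i) (x (i + 1)) (x (i + 2)), hx (i + 1) (by omega),
        dist_nonneg (x := x i) (y := x (i + 1))]
    · exact if_neg (by omega)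

/-- Let `P 0, …, P m` be a family of polygons with `N` sides and small mesh, the first and the last
of which are subdivided geodesics. The heat flow shows that the distance of these two is at most
the linear interpolation of the lengths of the two curves traced by the endpoints. -/
theorem dist_le_of_grid (hk : 0 < k) (hgeod : IsGeodesicMetricSpace Y) (h : MidpointCAT k ε K)
    {P : ℕ → ℕ → Y} {m N : ℕ} {q : ℝ} (hq : q ≤ ε / 4)
    (hK : ∀ z, ∀ i ≤ N, dist (P 0 i) z ≤ m * q + ε → z ∈ K)
    (hP : ∀ j < m, ∀ i ≤ N, dist (P j i) (P (j + 1) i) ≤ q)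
    (hS : ∀ j ≤ m, ∀ i < N, dist (P j i) (P j (i + 1)) ≤ ε / 8)
    (hfirst : ∀ i, i + 2 ≤ N → IsMid (P 0 (i + 1)) (P 0 i) (P 0 (i + 2)))
    (hlast : ∀ i, i + 2 ≤ N → IsMid (P m (i + 1)) (P m i) (P m (i + 2))) (hε : 0 < ε)
    (hq0 : 0 ≤ q) (hN : 0 < N) {i : ℕ} (hi : i ≤ N) :
    N * dist (P 0 i) (P m i) ≤
      (N - i) * ∑ j ∈ Finset.range m, dist (P j 0) (P (j + 1) 0) +
      i * ∑ j ∈ Finset.range m, dist (P j N) (P (j + 1) N) := by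
  choose mid hmid using fun x y : Y => exists_isMid hgeod x y
  have hNpos : (0 : ℝ) < N := by exact_mod_cast hN
  have hN1 : (1 : ℝ) ≤ N := by exact_mod_cast hN
  set ρ : ℝ := 1 - 1 / (N : ℝ) ^ 2 with hρ
  have hρ0 : 0 ≤ ρ := by
    rw [hρ, sub_nonneg, div_le_one (by positivity)]; nlinarith
  have hρ1 : ρ < 1 := by
    rw [hρ]; have : 0 < 1 / (N : ℝ) ^ 2 := by positivity
    linarith
  set G : ℕ → ℕ → ℕ → Y := fun n j => (heatStep mid N)^[n] (P j) with hG
  have hG1 : ∀ n j, G (n + 1) j = heatStep mid N (G n j) := fun n j =>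
    Function.iterate_succ_apply' _ _ _
  -- invariants of the flow; the last one bounds the deviation from the harmonic function with the
  -- same boundary values by a decaying multiple of `i (N - i)`
  have inv : ∀ n,
      (∀ j < m, ∀ i ≤ N, dist (G n j i) (G n (j + 1) i) ≤ q) ∧
      (∀ j ≤ m, ∀ i < N, dist (G n j i) (G n j (i + 1)) ≤ ε / 8) ∧
      (∀ i ≤ N, G n 0 i = P 0 i) ∧ (∀ i ≤ N, G n m i = P m i) ∧
      (∀ j < m, ∀ i ≤ N, dist (G n j i) (G n (j + 1) i) ≤
        ((N - i) * dist (P j 0) (P (j + 1) 0) + i * dist (P j N) (P (j + 1) N)) / N +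
          q * ρ ^ n * (i * (N - i))) := by
    intro n
    induction n with
    | zero =>
      refine ⟨hP, hS, fun _ _ => rfl, fun _ _ => rfl, ?_⟩
      intro j hj i hi
      change dist (P j i) (P (j + 1) i) ≤ _
      rcases Nat.eq_zero_or_pos i with rfl | hi0
      · apply le_of_eq; field_simp; simp
      rcases hi.eq_or_lt with rfl | hiN
      · apply le_of_eq; field_simp; simp
      have a1 : (1 : ℝ) ≤ i := by exact_mod_cast hi0
      have a2 : (i : ℝ) + 1 ≤ N := by exact_mod_cast hiN
      have a3 : q ≤ q * (i * (N - i)) := le_mul_of_one_le_right hq0 (by nlinarith)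
      have a4 : 0 ≤ ((N - i) * dist (P j 0) (P (j + 1) 0) + i * dist (P j N) (P (j + 1) N)) / N :=
        div_nonneg (add_nonneg (mul_nonneg (by linarith) dist_nonneg)
          (mul_nonneg (by linarith) dist_nonneg)) hNpos.le
      rw [pow_zero, mul_one]
      linarith [hP j hj i hi]
    | succ n ih =>
      obtain ⟨i1, i2, i3, i4, i5⟩ := ih
      have far : ∀ j ≤ m, ∀ i ≤ N, dist (P 0 i) (G n j i) ≤ m * q := by
        intro j hj i hi
        have hj' : dist (P 0 i) (G n j i) ≤ j * q := by
          induction j with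
          | zero => rw [i3 i hi]; simp
          | succ j ihj =>
            have := dist_triangle (P 0 i) (G n j i) (G n (j + 1) i)
            push_cast
            linarith [ihj (by omega), i1 j (by omega) i hi]
        have : (j : ℝ) * q ≤ m * q := mul_le_mul_of_nonneg_right (by exact_mod_cast hj) hq0
        linarith
      have inK : ∀ j ≤ m, ∀ i ≤ N, G n j i ∈ K := fun j hj i hi =>
        hK _ i hi (by linarith [far j hj i hi])
      have inK' : ∀ j ≤ m, ∀ i ≤ N, heatStep mid N (G n j) i ∈ K := by
        intro j hj i hi
        cases i with
        | zero => exact inK j hj 0 hi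
        | succ i =>
          rcases Nat.lt_or_ge (i + 1) N with h1 | h1
          · apply hK _ i (by omega)
            have := dist_heatStep_left hmid (i2 j hj) h1
            linarith [far j hj i (by omega),
              dist_triangle (P 0 i) (G n j i) (heatStep mid N (G n j) (i + 1))]
          · obtain rfl : N = i + 1 := by omega
            rw [heatStep_last]; exact inK j hj _ hi
      have sub : ∀ j < m, ∀ i, i + 2 ≤ N →
          dist (G (n + 1) j (i + 1)) (G (n + 1) (j + 1) (i + 1)) ≤
          (dist (G n j i) (G n (j + 1) i) + dist (G n j (i + 2)) (G n (j + 1) (i + 2))) / 2 := by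
        intro j hj i hi
        rw [hG1, hG1]
        exact dist_heatStep_heatStep_le hk hgeod h hmid (i2 j hj.le) (inK j hj.le) (inK' j hj.le)
          (i2 (j + 1) hj) (inK (j + 1) hj) (inK' (j + 1) hj)
          (fun i hi => (i1 j hj i hi).trans hq) hi
      have hzero : ∀ j, G (n + 1) j 0 = G n j 0 := fun j => by rw [hG1]; rfl
      have hend : ∀ j, G (n + 1) j N = G n j N := fun j => by rw [hG1, heatStep_last]
      refine ⟨?_, ?_, ?_, ?_, ?_⟩
      · intro j hj i hi
        cases i with
        | zero => rw [hzero, hzero]; exact i1 j hj 0 hi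
        | succ i =>
          rcases Nat.lt_or_ge (i + 1) N with h1 | h1
          · linarith [sub j hj i h1, i1 j hj i (by omega), i1 j hj (i + 2) h1]
          · obtain rfl : N = i + 1 := by omega
            rw [hend, hend]; exact i1 j hj _ hi
      · intro j hj i hi
        rw [hG1]
        exact dist_heatStep_succ_le hk hgeod h hmid (i2 j hj) (inK j hj) (inK' j hj) hi
      · intro i hi
        rw [hG1, heatStep_eq_self hk h hmid (i2 0 (by omega)) (inK 0 (by omega)) _ hi, i3 i hi]
        intro i hi
        rw [i3 _ (by omega), i3 _ (by omega), i3 _ hi]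
        exact hfirst i hi
      · intro i hi
        rw [hG1, heatStep_eq_self hk h hmid (i2 m le_rfl) (inK m le_rfl) _ hi, i4 i hi]
        intro i hi
        rw [i4 _ (by omega), i4 _ (by omega), i4 _ hi]
        exact hlast i hi
      · intro j hj i hi
        cases i with
        | zero => rw [hzero, hzero]; simpa using i5 j hj 0 hi
        | succ i =>
          rcases Nat.lt_or_ge (i + 1) N with h1 | h1
          · have s1 := sub j hj i h1
            have s2 := i5 j hj i (by omega)
            have s3 := i5 j hj (i + 2) h1
            set A := dist (P j 0) (P (j + 1) 0)
            set B := dist (P j N) (P (j + 1) N)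
            push_cast at s2 s3 ⊢
            have hiN : (i : ℝ) + 2 ≤ N := by exact_mod_cast h1
            have hi0 : (0 : ℝ) ≤ i := by positivity
            -- the function `i (N - i)` has second difference `-2` and is at most `N ^ 2`
            have key : ((i : ℝ) + 1) * (N - (i + 1)) - 1 ≤ ρ * ((i + 1) * (N - (i + 1))) := by
              rw [hρ]
              have : 1 / (N : ℝ) ^ 2 * ((i + 1) * (N - (i + 1))) ≤ 1 := by
                rw [one_div, inv_mul_le_iff₀ (by positivity)]
                nlinarith
              linarith
            have hqρ : 0 ≤ q * ρ ^ n := by positivity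
            have key2 := mul_le_mul_of_nonneg_left key hqρ
            have lin : (((N - i) * A + i * B) / N + ((N - (i + 2)) * A + (i + 2) * B) / N) / 2 =
                ((N - (i + 1)) * A + (i + 1) * B) / N := by field_simp; ring
            rw [pow_succ]
            nlinarith
          · obtain rfl : N = i + 1 := by omega
            rw [hend, hend]; simpa using i5 j hj _ hi
  have bound : ∀ n : ℕ, dist (P 0 i) (P m i) ≤
      ((N - i) * ∑ j ∈ Finset.range m, dist (P j 0) (P (j + 1) 0) +
      i * ∑ j ∈ Finset.range m, dist (P j N) (P (j + 1) N)) / N +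
        m * (q * ρ ^ n * (i * (N - i))) := by
    intro n
    obtain ⟨-, -, i3, i4, i5⟩ := inv n
    rw [← i3 i hi, ← i4 i hi]
    refine (dist_le_range_sum_dist (fun j => G n j i) m).trans ?_
    refine (Finset.sum_le_sum fun j hj => i5 j (Finset.mem_range.1 hj) i hi).trans ?_
    rw [Finset.sum_add_distrib, Finset.sum_const, Finset.card_range, nsmul_eq_mul,
      ← Finset.sum_div, Finset.sum_add_distrib, ← Finset.mul_sum, ← Finset.mul_sum]
  have lim : Tendsto (fun n : ℕ => ((N - i) * ∑ j ∈ Finset.range m, dist (P j 0) (P (j + 1) 0) +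
      i * ∑ j ∈ Finset.range m, dist (P j N) (P (j + 1) N)) / N +
        m * (q * ρ ^ n * (i * (N - i)))) atTop
      (𝓝 (((N - i) * ∑ j ∈ Finset.range m, dist (P j 0) (P (j + 1) 0) +
      i * ∑ j ∈ Finset.range m, dist (P j N) (P (j + 1) N)) / N +
        m * (q * 0 * (i * (N - i))))) :=
    ((((tendsto_pow_atTop_nhds_zero_of_lt_one hρ0 hρ1).const_mul q).mul_const _).const_mul
      _).const_add _
  have := ge_of_tendsto' lim bound
  rw [mul_zero, zero_mul, mul_zero, add_zero, le_div_iff₀ hNpos] at this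
  linarith

/-- Inserting the midpoints between consecutive rows of a grid halves the distance of consecutive
rows, and does not increase the mesh of the rows. -/
theorem exists_refinement (hk : 0 < k) (hgeod : IsGeodesicMetricSpace Y) {o : Y} {R : ℝ}
    (h : MidpointCAT k ε (Metric.closedBall o R)) {σ : ℝ} (hσ : σ ≤ ε / 4) {N : ℕ}
    {P : ℕ → ℕ → Y} {m : ℕ} {q r : ℝ} (hq : q ≤ ε / 4) (hq0 : 0 ≤ q) (hr : r + q ≤ R)
    (hK : ∀ j ≤ m, ∀ i ≤ N, P j i ∈ Metric.closedBall o r)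
    (hP : ∀ j < m, ∀ i ≤ N, dist (P j i) (P (j + 1) i) ≤ q)
    (hS : ∀ j ≤ m, ∀ i < N, dist (P j i) (P j (i + 1)) ≤ σ) (n : ℕ) :
    ∃ (P' : ℕ → ℕ → Y),
      (∀ j < m * 2 ^ n, ∀ i ≤ N, dist (P' j i) (P' (j + 1) i) ≤ q / 2 ^ n) ∧
      (∀ j ≤ m * 2 ^ n, ∀ i < N, dist (P' j i) (P' j (i + 1)) ≤ σ) ∧
      P' 0 = P 0 ∧ P' (m * 2 ^ n) = P m ∧
      ∀ i, ∑ j ∈ Finset.range (m * 2 ^ n), dist (P' j i) (P' (j + 1) i) =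
        ∑ j ∈ Finset.range m, dist (P j i) (P (j + 1) i) := by
  choose mid hmid using fun x y : Y => exists_isMid hgeod x y
  induction n generalizing P m q r with
  | zero =>
    refine ⟨P, ?_, ?_, rfl, ?_, ?_⟩
    · simpa using hP
    · simpa using hS
    · simp
    · simp
  | succ n ih =>
    set P₁ : ℕ → ℕ → Y := fun j i =>
      if j % 2 = 0 then P (j / 2) i else mid (P (j / 2) i) (P (j / 2 + 1) i) with hP₁
    have ev : ∀ j i, P₁ (2 * j) i = P j i := fun j i => by simp [hP₁]
    have od : ∀ j i, P₁ (2 * j + 1) i = mid (P j i) (P (j + 1) i) := fun j i => by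
      have e1 : (2 * j + 1) % 2 = 1 := by omega
      have e2 : (2 * j + 1) / 2 = j := by omega
      simp [hP₁, e1, e2]
    have d0 : ∀ j i, dist (P₁ (2 * j) i) (P₁ (2 * j + 1) i) = dist (P j i) (P (j + 1) i) / 2 :=
      fun j i => by rw [ev, od, (hmid _ _).1]
    have d1 : ∀ j i, dist (P₁ (2 * j + 1) i) (P₁ (2 * j + 1 + 1) i) =
        dist (P j i) (P (j + 1) i) / 2 := fun j i => by
      rw [show 2 * j + 1 + 1 = 2 * (j + 1) by ring, ev, od, (hmid _ _).2]
    have hr' : ∀ j < m, ∀ i ≤ N, P₁ (2 * j + 1) i ∈ Metric.closedBall o (r + q / 2) := by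
      intro j hj i hi
      have a1 := Metric.mem_closedBall.1 (hK j hj.le i hi)
      have a2 := d0 j i
      rw [ev] at a2
      rw [Metric.mem_closedBall]
      have := dist_triangle_left (P₁ (2 * j + 1) i) o (P j i)
      linarith [hP j hj i hi]
    obtain ⟨P', b1, b2, b3, b4, b5⟩ := ih (P := P₁) (m := 2 * m) (q := q / 2) (r := r + q / 2)
      (by linarith) (by linarith) (by linarith)
      (by
        intro j hj i hi
        obtain ⟨l, rfl | rfl⟩ := Nat.even_or_odd' j
        · rw [ev]
          exact Metric.closedBall_subset_closedBall (by linarith) (hK l (by omega) i hi)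
        · exact hr' l (by omega) i hi)
      (by
        intro j hj i hi
        obtain ⟨l, rfl | rfl⟩ := Nat.even_or_odd' j
        · rw [d0]; linarith [hP l (by omega) i hi]
        · rw [d1]; linarith [hP l (by omega) i hi])
      (by
        intro j hj i hi
        obtain ⟨l, rfl | rfl⟩ := Nat.even_or_odd' j
        · rw [ev, ev]; exact hS l (by omega) i hi
        · have m1 := hr' l (by omega) i (by omega)
          have m2 := hr' l (by omega) (i + 1) hi
          rw [od] at m1 m2 ⊢
          rw [od]
          have sub : ∀ s ≤ R, Metric.closedBall o s ⊆ Metric.closedBall o R := fun s hs =>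
            Metric.closedBall_subset_closedBall hs
          have := h.dist_mid_quad_le hk hgeod (hmid _ _) (hmid _ _)
            (sub r (by linarith) (hK l (by omega) i (by omega)))
            (sub r (by linarith) (hK (l + 1) (by omega) (i + 1) hi))
            (sub _ (by linarith) m1) (sub _ (by linarith) m2)
            ((hP l (by omega) i (by omega)).trans hq) ((hP l (by omega) (i + 1) hi).trans hq)
            ((hS l (by omega) i hi).trans hσ) ((hS (l + 1) (by omega) i hi).trans hσ)
          linarith [hS l (by omega) i hi, hS (l + 1) (by omega) i hi])
    have e : m * 2 ^ (n + 1) = 2 * m * 2 ^ n := by ring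
    have eq2 : q / 2 ^ (n + 1) = q / 2 / 2 ^ n := by rw [pow_succ]; field_simp
    refine ⟨P', ?_, ?_, ?_, ?_, ?_⟩
    · rw [e, eq2]; exact b1
    · rw [e]; exact b2
    · rw [b3]; funext i; exact ev 0 i
    · rw [e, b4]; funext i; exact ev m i
    · intro i
      rw [e, b5, sum_range_two_mul]
      refine Finset.sum_congr rfl fun j _ => ?_
      rw [d0, d1, add_halves]

end

/-! ### Global convexity of the metric -/

section

variable {Y : Type*} [MetricSpace Y]

/-- A continuous map is uniformly continuous on a box, in the form used to choose grids. -/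
theorem exists_mesh {H : ℝ × ℝ → Y} (hH : Continuous H) {e : ℝ} (he : 0 < e) :
    ∃ δ > 0, ∀ s ∈ Icc (0 : ℝ) 3, ∀ t ∈ Icc (0 : ℝ) 1, ∀ s' ∈ Icc (0 : ℝ) 3, ∀ t' ∈ Icc (0 : ℝ) 1,
      |s - s'| < δ → |t - t'| < δ → dist (H (s, t)) (H (s', t')) ≤ e := by
  have hcomp : IsCompact (Icc (0 : ℝ) 3 ×ˢ Icc (0 : ℝ) 1) := isCompact_Icc.prod isCompact_Icc
  obtain ⟨δ, hδ, h⟩ := Metric.uniformContinuousOn_iff.1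
    (hcomp.uniformContinuousOn_of_continuous hH.continuousOn) e he
  refine ⟨δ, hδ, fun s hs t ht s' hs' t' ht' h1 h2 => (h (s, t) ⟨hs, ht⟩ (s', t') ⟨hs', ht'⟩ ?_).le⟩
  rw [Prod.dist_eq, Real.dist_eq, Real.dist_eq]
  exact max_lt h1 h2

/-- The metric is convex: the distance of two geodesic segments, parametrised proportionally to
arc length on the unit interval, is at most the interpolation of its values at the ends. -/
def HasConvexMetric (Y : Type*) [MetricSpace Y] : Prop :=
  ∀ ⦃γ γ' : ℝ → Y⦄ ⦃x y x' y' : Y⦄, IsGeodesicSegment γ x y → IsGeodesicSegment γ' x' y' →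
    ∀ t ∈ Icc (0 : ℝ) 1,
      dist (γ (dist x y * t)) (γ' (dist x' y' * t)) ≤ (1 - t) * dist x x' + t * dist y y'

/-- Local convexity implies global convexity. Simple connectedness enters through a homotopy between
the two segments, which the heat flow straightens. -/
theorem hasConvexMetric [SimplyConnectedSpace Y] [ProperSpace Y]
    (hgeod : IsGeodesicMetricSpace Y) {k : ℝ} (hk : 0 < k)
    (hloc : ∀ K : Set Y, IsCompact K → ∃ ε > 0, ε ≤ 1 ∧ MidpointCAT k ε K) :
    HasConvexMetric Y := by
  intro γ γ' x y x' y' h h' t ht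
  obtain ⟨α, hα⟩ := hgeod x x'
  obtain ⟨β, hβ⟩ := hgeod y y'
  have c0 : clamp 0 = 0 := clamp_of_nonpos le_rfl
  have c1 : clamp 1 = 1 := clamp_of_one_le le_rfl
  obtain ⟨H, hH, H0, H3, Hl, Hr⟩ := exists_filling h.continuous_clamp h'.continuous_clamp
    hα.continuous_clamp hβ.continuous_clamp
    (by simp [c0, h.1, hα.1]) (by simp [c1, h.2.1, c0, hβ.1])
    (by simp [c0, c1, h'.1, hα.2.1]) (by simp [c1, h'.2.1, hβ.2.1])
  -- the image of the homotopy lies in a ball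
  have hcomp : IsCompact (Icc (0 : ℝ) 3 ×ˢ Icc (0 : ℝ) 1) := isCompact_Icc.prod isCompact_Icc
  obtain ⟨R₁, hR₁⟩ := (hcomp.image hH).isBounded.subset_closedBall x
  have inball : ∀ s ∈ Icc (0 : ℝ) 3, ∀ t ∈ Icc (0 : ℝ) 1, H (s, t) ∈ Metric.closedBall x R₁ :=
    fun s hs t ht => hR₁ ⟨(s, t), ⟨hs, ht⟩, rfl⟩
  obtain ⟨ε₀, hε₀, hε₀1, M₀⟩ := hloc (Metric.closedBall x (R₁ + 1)) (isCompact_closedBall _ _)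
  -- a coarse subdivision into `m` rows
  obtain ⟨δ₀, hδ₀, hm₀⟩ := exists_mesh hH (e := ε₀ / 8) (by linarith)
  obtain ⟨m, hm⟩ := exists_nat_gt (3 / δ₀)
  have hmpos : (0 : ℝ) < m := lt_of_le_of_lt (by positivity) hm
  set q := ε₀ / 8 with hq
  -- the ball which contains all later polygons, and its scale
  obtain ⟨ε₁, hε₁, hε₁1, M₁⟩ := hloc (Metric.closedBall x (R₁ + m * q + 1))
    (isCompact_closedBall _ _)
  obtain ⟨δ₁, hδ₁, hm₁⟩ := exists_mesh hH (e := min (ε₀ / 4) (ε₁ / 8)) (by positivity)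
  obtain ⟨n, hn⟩ := exists_nat_gt (q / (ε₁ / 4))
  have hn2 : q / 2 ^ n ≤ ε₁ / 4 := by
    have h2 : (n : ℝ) < 2 ^ n := by exact_mod_cast Nat.lt_two_pow_self
    rw [div_lt_iff₀ (by positivity)] at hn
    rw [div_le_iff₀ (by positivity)]
    nlinarith
  have grid : ∀ N : ℕ, 1 / δ₁ < N → ∀ i ≤ N,
      N * dist (γ (dist x y * (i / N))) (γ' (dist x' y' * (i / N))) ≤
        (N - i) * dist x x' + i * dist y y' := by
    intro N hN i hi
    have hNpos : (0 : ℝ) < N := lt_of_le_of_lt (by positivity) hN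
    have hN0 : 0 < N := by exact_mod_cast hNpos
    set P : ℕ → ℕ → Y := fun j i => H (3 * j / m, i / N) with hP
    have col : ∀ j ≤ m, (3 * j / m : ℝ) ∈ Icc (0 : ℝ) 3 := fun j hj => by
      have : (j : ℝ) ≤ m := by exact_mod_cast hj
      refine ⟨by positivity, ?_⟩
      rw [div_le_iff₀ hmpos]; linarith
    have row : ∀ i ≤ N, (i / N : ℝ) ∈ Icc (0 : ℝ) 1 := fun i hi => by
      have : (i : ℝ) ≤ N := by exact_mod_cast hi
      refine ⟨by positivity, ?_⟩
      rw [div_le_iff₀ hNpos]; linarith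
    have hPq : ∀ j < m, ∀ i ≤ N, dist (P j i) (P (j + 1) i) ≤ q := by
      intro j hj i hi
      apply hm₀ _ (col j hj.le) _ (row i hi) _ (col (j + 1) hj) _ (row i hi)
      · rw [show (3 * (j : ℝ) / m - 3 * ((j + 1 : ℕ) : ℝ) / m) = -(3 / m) by
          push_cast; field_simp; ring, abs_neg, abs_of_pos (by positivity)]
        rw [div_lt_iff₀ hδ₀] at hm
        rw [div_lt_iff₀ hmpos]; linarith
      · simpa using hδ₀
    have hPσ : ∀ j ≤ m, ∀ i < N, dist (P j i) (P j (i + 1)) ≤ min (ε₀ / 4) (ε₁ / 8) := by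
      intro j hj i hi
      apply hm₁ _ (col j hj) _ (row i hi.le) _ (col j hj) _ (row (i + 1) hi)
      · simpa using hδ₁
      · rw [show ((i : ℝ) / N - ((i + 1 : ℕ) : ℝ) / N) = -(1 / N) by
          push_cast; field_simp; ring, abs_neg, abs_of_pos (by positivity)]
        rw [div_lt_iff₀ hδ₁] at hN
        rw [div_lt_iff₀ hNpos]; linarith
    obtain ⟨P', b1, b2, b3, b4, b5⟩ := exists_refinement hk hgeod M₀ (min_le_left _ _)
      (r := R₁) (by linarith) (by positivity) (by linarith)
      (fun j hj i hi => inball _ (col j hj) _ (row i hi)) hPq hPσ n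
    have first : ∀ i ≤ N, P' 0 i = γ (dist x y * clamp (i / N)) := by
      intro i hi
      rw [b3]
      simp only [Nat.cast_zero, mul_zero, zero_div]
      exact H0 _ (row i hi)
    have last : ∀ i ≤ N, P' (m * 2 ^ n) i = γ' (dist x' y' * clamp (i / N)) := by
      intro i hi
      rw [b4]
      simp only [mul_div_assoc, div_self hmpos.ne', mul_one]
      exact H3 _ (row i hi)
    have mids : ∀ {γ : ℝ → Y} {x y : Y}, IsGeodesicSegment γ x y → ∀ i, i + 2 ≤ N →
        IsMid (γ (dist x y * clamp ((i + 1 : ℕ) / N))) (γ (dist x y * clamp (i / N)))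
          (γ (dist x y * clamp ((i + 2 : ℕ) / N))) := by
      intro γ x y h i hi
      constructor
      all_goals
        rw [h.dist_clamp, h.dist_clamp, clamp_of_mem (row i (by omega)),
          clamp_of_mem (row (i + 1) (by omega)), clamp_of_mem (row (i + 2) hi)]
        push_cast
      · rw [show ((i : ℝ) / N - (i + 1) / N) = -(1 / N) by field_simp; ring,
          show ((i : ℝ) / N - (i + 2) / N) = -(2 / N) by field_simp; ring, abs_neg, abs_neg,
          abs_of_pos (by positivity), abs_of_pos (by positivity)]
        ring
      · rw [show (((i : ℝ) + 1) / N - (i + 2) / N) = -(1 / N) by field_simp; ring,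
          show ((i : ℝ) / N - (i + 2) / N) = -(2 / N) by field_simp; ring, abs_neg, abs_neg,
          abs_of_pos (by positivity), abs_of_pos (by positivity)]
        ring
    have tele : ∀ {γ : ℝ → Y} {x y : Y}, IsGeodesicSegment γ x y →
        ∑ j ∈ Finset.range m, dist (γ (dist x y * clamp (3 * j / m - 1)))
          (γ (dist x y * clamp (3 * ((j + 1 : ℕ) : ℝ) / m - 1))) = dist x y := by
      intro γ x y h
      have : ∀ j ∈ Finset.range m, dist (γ (dist x y * clamp (3 * j / m - 1)))
          (γ (dist x y * clamp (3 * ((j + 1 : ℕ) : ℝ) / m - 1))) =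
          dist x y * clamp (3 * ((j + 1 : ℕ) : ℝ) / m - 1) - dist x y * clamp (3 * j / m - 1) := by
        intro j _
        rw [h.dist_clamp, abs_sub_comm, abs_of_nonneg, mul_sub]
        rw [sub_nonneg]
        apply clamp_mono
        push_cast
        gcongr
        linarith
      rw [Finset.sum_congr rfl this,
        Finset.sum_range_sub (fun j : ℕ => dist x y * clamp (3 * (j : ℝ) / m - 1))]
      simp only [mul_div_assoc, div_self hmpos.ne', mul_one, Nat.cast_zero, zero_div, mul_zero]
      rw [clamp_of_one_le (by norm_num), clamp_of_nonpos (by norm_num)]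
      ring
    have key := dist_le_of_grid hk hgeod M₁ (P := P') (m := m * 2 ^ n) hn2
      (by
        intro z i hi hz
        rw [b3] at hz
        change dist (P 0 i) z ≤ _ at hz
        have e : ((m * 2 ^ n : ℕ) : ℝ) * (q / 2 ^ n) = m * q := by push_cast; field_simp
        rw [e] at hz
        have h1 := Metric.mem_closedBall.1 (inball _ (col 0 (Nat.zero_le _)) _ (row i hi))
        change dist (P 0 i) x ≤ R₁ at h1
        rw [Metric.mem_closedBall]
        have := dist_triangle_left z x (P 0 i)
        linarith)
      b1 (fun j hj i hi => (b2 j hj i hi).trans (min_le_right _ _))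
      (by
        intro i hi
        rw [first _ (by omega), first _ (by omega), first _ hi]
        exact mids h i hi)
      (by
        intro i hi
        rw [last _ (by omega), last _ (by omega), last _ hi]
        exact mids h' i hi)
      hε₁ (by positivity) hN0 hi
    rw [b5, b5, first i hi, last i hi, clamp_of_mem (row i hi)] at key
    have s1 : ∑ j ∈ Finset.range m, dist (P j 0) (P (j + 1) 0) = dist x x' := by
      rw [← tele hα]
      refine Finset.sum_congr rfl fun j _ => ?_
      simp only [hP, Nat.cast_zero, zero_div, Hl, clamp_clamp]
    have s2 : ∑ j ∈ Finset.range m, dist (P j N) (P (j + 1) N) = dist y y' := by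
      rw [← tele hβ]
      refine Finset.sum_congr rfl fun j _ => ?_
      simp only [hP, div_self hNpos.ne', Hr, clamp_clamp]
    rwa [s1, s2] at key
  -- the fractions `⌊t N⌋ / N` tend to `t`
  set u : ℕ → ℝ := fun N => (⌊t * N⌋₊ : ℝ) / N with hu
  have hut : Tendsto u atTop (𝓝 t) :=
    (tendsto_nat_floor_mul_div_atTop ht.1).comp tendsto_natCast_atTop_atTop
  have hut' : Tendsto (fun N => clamp (u N)) atTop (𝓝 t) := by
    have := (continuous_clamp.tendsto t).comp hut
    rwa [clamp_of_mem ht] at this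
  have lhs : Tendsto (fun N => dist (γ (dist x y * clamp (u N))) (γ' (dist x' y' * clamp (u N))))
      atTop (𝓝 (dist (γ (dist x y * t)) (γ' (dist x' y' * t)))) := by
    have := (((h.continuous_clamp.dist h'.continuous_clamp).tendsto t).comp hut)
    rwa [clamp_of_mem ht] at this
  have rhs : Tendsto (fun N => (1 - u N) * dist x x' + u N * dist y y') atTop
      (𝓝 ((1 - t) * dist x x' + t * dist y y')) :=
    ((tendsto_const_nhds.sub hut).mul_const _).add (hut.mul_const _)
  refine le_of_tendsto_of_tendsto lhs rhs ?_
  obtain ⟨N₀, hN₀⟩ := exists_nat_gt (1 / δ₁)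
  filter_upwards [eventually_ge_atTop N₀] with N hN
  have hN1 : 1 / δ₁ < N := hN₀.trans_le (by exact_mod_cast hN)
  have hNpos : (0 : ℝ) < N := lt_of_le_of_lt (by positivity) hN1
  have hle : ⌊t * N⌋₊ ≤ N := by
    apply Nat.floor_le_of_le
    nlinarith [ht.2]
  have hmem : u N ∈ Icc (0 : ℝ) 1 := by
    have : ((⌊t * N⌋₊ : ℕ) : ℝ) ≤ N := by exact_mod_cast hle
    exact ⟨by positivity, by rw [hu]; simp only; rw [div_le_one hNpos]; exact this⟩
  have := grid N hN1 _ hle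
  rw [clamp_of_mem hmem]
  apply le_of_mul_le_mul_left _ hNpos
  refine this.trans (le_of_eq ?_)
  simp only [hu]
  field_simp

end

/-! ### Exponential contraction along geodesics issuing from a point -/

section

variable {Y : Type*} [MetricSpace Y]

/-- A strict discrete subsolution attains no positive interior maximum. -/
theorem nonpos_of_subsolution {f : ℕ → ℝ} {c : ℝ} {N : ℕ} (hc : 1 < c) (h0 : f 0 ≤ 0)
    (hN : f N ≤ 0) (h : ∀ i, i + 2 ≤ N → c * f (i + 1) ≤ (f i + f (i + 2)) / 2) {i : ℕ}
    (hi : i ≤ N) : f i ≤ 0 := by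
  obtain ⟨j, hj, hmax⟩ := Finset.exists_max_image (Finset.range (N + 1)) f ⟨0, by simp⟩
  have hj' : j ≤ N := by have := Finset.mem_range.1 hj; omega
  have hmax' : ∀ i ≤ N, f i ≤ f j := fun i hi => hmax i (Finset.mem_range.2 (by omega))
  refine (hmax' i hi).trans ?_
  by_contra! hpos
  cases j with
  | zero => linarith
  | succ j =>
    rcases hj'.eq_or_lt with h1 | h1
    · rw [← h1] at hN; linarith
    · have := h j h1
      nlinarith [hmax' j (by omega), hmax' (j + 2) h1]

/-- The algebra behind the contraction of thin quadrilaterals, in terms of hyperbolic cosines: `A`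
and `B` of the short sides, `C` of half a long side, `p` and `q` of half the diagonals, `w` of the
median. To first order in `A - 1` and `B - 1` the hypotheses give
`w - 1 ≤ (A + B - 2) / (2 C ^ 2)`; one factor `C` absorbs the quadratic error. -/
theorem mul_sub_one_le_of_quad {A B C p q w a₁ a₂ b₁ b₂ : ℝ} (C1 : 1 ≤ C) (hp : C ≤ p)
    (hq : C ≤ q) (A0 : 1 ≤ A) (B0 : 1 ≤ B) (A1 : A ≤ C) (B1 : B ≤ C)
    (i1 : 2 * b₁ * C ≤ A + (2 * p ^ 2 - 1)) (i2 : 2 * b₂ * C ≤ 2 * q ^ 2 - 1 + B)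
    (i3 : 2 * w * C ≤ b₁ + b₂) (i4 : 2 * a₁ * p ≤ 2 * C ^ 2 - 1 + B)
    (i5 : 2 * a₂ * p ≤ A + (2 * C ^ 2 - 1)) (i6 : 2 * q ≤ a₁ + a₂) :
    C * (w - 1) ≤ (A - 1 + (B - 1)) / 2 := by
  obtain ⟨α, rfl⟩ : ∃ α, p = C + α := ⟨p - C, by ring⟩
  obtain ⟨β, rfl⟩ : ∃ β, q = C + β := ⟨q - C, by ring⟩
  have hα : 0 ≤ α := by linarith
  have hβ : 0 ≤ β := by linarith
  have hαβ0 := mul_nonneg hα hβ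
  obtain ⟨T, hT⟩ : ∃ T, A + B - 2 = 4 * T := ⟨(A + B - 2) / 4, by ring⟩
  have hT0 : 0 ≤ T := by linarith
  have hpq : (C + α) * (C + β) ≤ C ^ 2 + T := by
    have := mul_le_mul_of_nonneg_left i6 (show 0 ≤ C + α by linarith)
    linarith
  have hαβ : C * (α + β) ≤ T := by linarith
  have hw : 4 * w * C ^ 2 ≤ A + B + 2 * (C + α) ^ 2 + 2 * (C + β) ^ 2 - 2 := by
    have := mul_le_mul_of_nonneg_left i3 (show 0 ≤ C by linarith)
    linarith
  have hw2 : 4 * w * C ^ 2 ≤ 4 * C ^ 2 + 8 * T + 2 * (α + β) ^ 2 := by linarith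
  have hw3 : 4 * (w - 1) * C ^ 4 ≤ 8 * T * C ^ 2 + 2 * T ^ 2 := by
    have h1 : (C * (α + β)) ^ 2 ≤ T ^ 2 :=
      pow_le_pow_left₀ (mul_nonneg (by linarith) (by linarith)) hαβ 2
    have h2 := mul_le_mul_of_nonneg_left hw2 (sq_nonneg C)
    linarith
  have hw4 : 4 * (w - 1) * C ^ 4 ≤ 8 * T * C ^ 3 := by
    have s1 := mul_le_mul_of_nonneg_left (show 2 * T ≤ C - 1 by linarith) hT0
    have s2 : T * (C - 1) ≤ T * (C - 1) * (8 * C ^ 2) :=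
      le_mul_of_one_le_right (mul_nonneg hT0 (by linarith)) (by nlinarith)
    linarith
  have hC3 : 0 < 4 * C ^ 3 := by positivity
  apply le_of_mul_le_mul_left _ hC3
  rw [show A - 1 + (B - 1) = 4 * T by linarith]
  linarith

open Real in
/-- Two geodesic segments of length `2 δ` in a region of curvature at most `-k²`, neither of which
is shifted along the other, in the sense that the diagonals have length at least `2 δ`. The gain
over the flat case is the factor `cosh (k δ)`. -/
theorem MidpointCAT.cosh_mul_le {k ε δ : ℝ} {K : Set Y} (hk : 0 < k) (h : MidpointCAT k ε K)
    (hgeod : IsGeodesicMetricSpace Y) {x z y x' z' y' : Y} (hz : IsMid z x y)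
    (hz' : IsMid z' x' y') (hxy : dist x y = 2 * δ) (hxy' : dist x' y' = 2 * δ)
    (hd1 : 2 * δ ≤ dist x y') (hd2 : 2 * δ ≤ dist y x') (hx : dist x x' ≤ δ)
    (hy : dist y y' ≤ δ) (hδε : 3 * δ ≤ ε) (xK : x ∈ K) (yK : y ∈ K) (xK' : x' ∈ K)
    (zK' : z' ∈ K) :
    cosh (k * δ) * (cosh (k * dist z z') - 1) ≤
      ((cosh (k * dist x x') - 1) + (cosh (k * dist y y') - 1)) / 2 := by
  have hδ : 0 ≤ δ := dist_nonneg.trans hx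
  -- `n` is the midpoint of a diagonal
  obtain ⟨n, hn⟩ := exists_isMid hgeod x y'
  have hxy1 : dist x y' ≤ 3 * δ := by linarith [dist_triangle x y y']
  have hyx1 : dist y x' ≤ 3 * δ := by linarith [dist_triangle y x x', dist_comm x y]
  have ez : dist x' z' = δ := by rw [hz'.1, hxy']; ring
  have ez' : dist z' y' = δ := by rw [hz'.2, hxy']; ring
  have i1 := h x xK x' y' z' (by linarith) (by linarith) hz'
  have i2 := h y yK x' y' z' (by linarith) (by linarith) hz'
  have i3 := h z' zK' x y z
    (by linarith [dist_triangle z' x' x, dist_comm x x', dist_comm x' z'])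
    (by linarith [dist_triangle z' y' y, dist_comm y y']) hz
  have i4 := h y yK x y' n (by linarith [dist_comm x y]) (by linarith) hn
  have i5 := h x' xK' x y' n (by linarith [dist_comm x x']) (by linarith) hn
  have q1 := dist_triangle y n x'
  rw [dist_comm x' n, dist_comm x' x, hxy'] at i5
  rw [dist_comm y x, hxy] at i4
  rw [hxy, dist_comm z' z, dist_comm z' x, dist_comm z' y] at i3
  rw [hxy'] at i1 i2
  rw [show 2 * δ / 2 = δ by ring] at i1 i2 i3
  have dbl : ∀ a, cosh (k * a) = 2 * cosh (k * (a / 2)) ^ 2 - 1 := fun a => by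
    rw [show k * a = 2 * (k * (a / 2)) by ring, cosh_two_mul, cosh_sq (k * (a / 2))]; ring
  rw [dbl (dist x y')] at i1
  rw [dbl (dist y x')] at i2
  have e2δ : cosh (k * (2 * δ)) = 2 * cosh (k * δ) ^ 2 - 1 := by
    rw [dbl]; congr 4; ring
  rw [e2δ] at i4 i5
  -- the second diagonal is controlled by the median distances from the midpoint of the first
  have i6 : 2 * cosh (k * (dist y x' / 2)) ≤ cosh (k * dist y n) + cosh (k * dist n x') := by
    set u := k * dist y n
    set v := k * dist n x'
    have huv : cosh u + cosh v = 2 * cosh ((u + v) / 2) * cosh ((u - v) / 2) := by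
      have e1 : (u + v) / 2 + (u - v) / 2 = u := by ring
      have e2 : (u + v) / 2 - (u - v) / 2 = v := by ring
      have e3 := cosh_add ((u + v) / 2) ((u - v) / 2)
      have e4 := cosh_sub ((u + v) / 2) ((u - v) / 2)
      rw [e1] at e3
      rw [e2] at e4
      linarith
    have m1 : cosh (k * (dist y x' / 2)) ≤ cosh ((u + v) / 2) := by
      rw [cosh_le_cosh, abs_of_nonneg (by positivity), abs_of_nonneg (by positivity)]
      simp only [u, v]
      rw [← mul_add, mul_div_assoc]
      gcongr
    have m2 := le_mul_of_one_le_right (cosh_pos ((u + v) / 2)).le (one_le_cosh ((u - v) / 2))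
    rw [huv]
    linarith
  have C1 : 1 ≤ cosh (k * δ) := one_le_cosh _
  have mono : ∀ s t, 0 ≤ s → s ≤ t → cosh (k * s) ≤ cosh (k * t) := fun s t hs hst => by
    rw [cosh_le_cosh, abs_of_nonneg (by positivity), abs_of_nonneg (mul_nonneg hk.le (hs.trans hst))]
    gcongr
  have p1 := mono δ (dist x y' / 2) hδ (by linarith)
  have q2 := mono δ (dist y x' / 2) hδ (by linarith)
  have A1 := mono (dist x x') δ dist_nonneg hx
  have B1 := mono (dist y y') δ dist_nonneg hy
  have A0 : 1 ≤ cosh (k * dist x x') := one_le_cosh _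
  have B0 : 1 ≤ cosh (k * dist y y') := one_le_cosh _
  exact mul_sub_one_le_of_quad C1 p1 q2 A0 B0 A1 B1 i1 i2 i3 i4 i5 i6

open Real in
theorem sq_half_le_cosh_sub_one {x : ℝ} (hx : 0 ≤ x) : x ^ 2 / 2 ≤ cosh x - 1 := by
  have h1 : x / 2 ≤ sinh (x / 2) := self_le_sinh_iff.2 (by linarith)
  have h2 : cosh x = 1 + 2 * sinh (x / 2) ^ 2 := by
    rw [show x = 2 * (x / 2) by ring, cosh_two_mul, cosh_sq]; ring_nf
  rw [h2]
  nlinarith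

open Real in
theorem cosh_sub_one_le_sq {x : ℝ} (hx : 0 ≤ x) (hx1 : x ≤ 1) : cosh x - 1 ≤ x ^ 2 := by
  have h1 := cosh_le_exp_half_sq x
  have hs : 0 ≤ x ^ 2 / 2 := by positivity
  have h2 := abs_exp_sub_one_le (x := x ^ 2 / 2) (by rw [abs_of_nonneg hs]; nlinarith)
  rw [abs_of_nonneg hs] at h2
  linarith [le_abs_self (exp (x ^ 2 / 2) - 1)]

theorem IsGeodesicSegment.initial {γ : ℝ → Y} {x y : Y} (h : IsGeodesicSegment γ x y) {r : ℝ}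
    (hr : r ∈ Icc 0 (dist x y)) : IsGeodesicSegment γ x (γ r) := by
  have e := h.dist_left hr
  refine ⟨h.1, by rw [e], ?_⟩
  rw [e]
  exact fun s hs t ht => h.2.2 s ⟨hs.1, hs.2.trans hr.2⟩ t ⟨ht.1, ht.2.trans hr.2⟩

/-- Two geodesics issuing from `b` which are close at distance `R` from `b` are closer, by an
exponential factor, at distance `R - a` from `b`. -/
theorem exists_thin_contraction (hgeod : IsGeodesicMetricSpace Y) [ProperSpace Y] {k : ℝ}
    (hk : 0 < k) (hloc : ∀ K : Set Y, IsCompact K → ∃ ε > 0, ε ≤ 1 ∧ MidpointCAT k ε K)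
    (hconv : HasConvexMetric Y) (b : Y) {a : ℝ} (ha : 0 < a) (m : ℕ) :
    ∃ η > 0, ∀ (γ γ' : ℝ → Y) (x x' : Y), IsGeodesicSegment γ b x → IsGeodesicSegment γ' b x' →
      (m + 1) * a ≤ dist b x → (m + 1) * a ≤ dist b x' →
      dist (γ ((m + 1) * a)) (γ' ((m + 1) * a)) ≤ η →
      dist (γ (m * a)) (γ' (m * a)) ≤
        2 * Real.exp (-(k * a / 2)) * dist (γ ((m + 1) * a)) (γ' ((m + 1) * a)) := by
  obtain ⟨ε, hε, -, hcat⟩ := hloc (Metric.closedBall b ((m + 1) * a)) (isCompact_closedBall _ _)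
  obtain ⟨n, hn⟩ := exists_nat_gt (3 * a / ε)
  have hnpos : (0 : ℝ) < n := lt_of_le_of_lt (by positivity) hn
  set δ := a / n with hδ
  have hδpos : 0 < δ := by positivity
  have hδε : 3 * δ ≤ ε := by
    rw [div_lt_iff₀ hε] at hn
    rw [hδ, ← mul_div_assoc, div_le_iff₀ hnpos]; linarith
  refine ⟨min δ (1 / k), by positivity, ?_⟩
  intro γ γ' x x' h h' hx hx' hη
  set R : ℝ := (m + 1) * a with hR
  have hRpos : 0 < R := by positivity
  set W := dist (γ R) (γ' R) with hW
  set N := (m + 1) * n with hN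
  have hNδ : (N : ℝ) * δ = R := by rw [hN, hδ, hR]; push_cast; field_simp
  have hmδ : ((m * n : ℕ) : ℝ) * δ = m * a := by rw [hδ]; push_cast; field_simp
  have par : ∀ i ≤ N, (i : ℝ) * δ ∈ Icc 0 R := fun i hi => by
    refine ⟨by positivity, ?_⟩
    rw [← hNδ]; gcongr
  have dl : ∀ r ∈ Icc 0 R, dist b (γ r) = r := fun r hr => h.dist_left ⟨hr.1, hr.2.trans hx⟩
  have dl' : ∀ r ∈ Icc 0 R, dist b (γ' r) = r := fun r hr => h'.dist_left ⟨hr.1, hr.2.trans hx'⟩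
  have hRm : R ∈ Icc 0 R := ⟨hRpos.le, le_rfl⟩
  have hWδ : ∀ r ∈ Icc 0 R, dist (γ r) (γ' r) ≤ δ := by
    intro r hr
    have := hconv (h.initial ⟨hRpos.le, hx⟩) (h'.initial ⟨hRpos.le, hx'⟩) (r / R)
      ⟨div_nonneg hr.1 hRpos.le, div_le_one_of_le₀ hr.2 hRpos.le⟩
    rw [dl R hRm, dl' R hRm, mul_div_cancel₀ _ hRpos.ne', dist_self, mul_zero, zero_add] at this
    have h1 : r / R * dist (γ R) (γ' R) ≤ 1 * dist (γ R) (γ' R) := by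
      gcongr; exact div_le_one_of_le₀ hr.2 hRpos.le
    linarith [hη.trans (min_le_left _ _)]
  have hball : ∀ r ∈ Icc 0 R, γ r ∈ Metric.closedBall b R := fun r hr => by
    rw [Metric.mem_closedBall, dist_comm, dl r hr]; exact hr.2
  have hball' : ∀ r ∈ Icc 0 R, γ' r ∈ Metric.closedBall b R := fun r hr => by
    rw [Metric.mem_closedBall, dist_comm, dl' r hr]; exact hr.2
  have seg : ∀ {γ : ℝ → Y} {x : Y}, IsGeodesicSegment γ b x → R ≤ dist b x → ∀ i j : ℕ, i ≤ N →
      j ≤ N → dist (γ (i * δ)) (γ (j * δ)) = |(i : ℝ) - j| * δ := by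
    intro γ x h hx i j hi hj
    rw [h.2.2 _ ⟨(par i hi).1, (par i hi).2.trans hx⟩ _ ⟨(par j hj).1, (par j hj).2.trans hx⟩,
      ← sub_mul, abs_mul, abs_of_pos hδpos]
  have mids : ∀ {γ : ℝ → Y} {x : Y}, IsGeodesicSegment γ b x → R ≤ dist b x → ∀ i : ℕ, i + 2 ≤ N →
      IsMid (γ ((i + 1 : ℕ) * δ)) (γ (i * δ)) (γ ((i + 2 : ℕ) * δ)) ∧
        dist (γ (i * δ)) (γ ((i + 2 : ℕ) * δ)) = 2 * δ := by
    intro γ x h hx i hi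
    have e2 : dist (γ (i * δ)) (γ ((i + 2 : ℕ) * δ)) = 2 * δ := by
      rw [seg h hx i (i + 2) (by omega) hi]; push_cast; norm_num
    refine ⟨⟨?_, ?_⟩, e2⟩
    · rw [e2, seg h hx i (i + 1) (by omega) (by omega)]; push_cast; norm_num
    · rw [e2, seg h hx (i + 1) (i + 2) (by omega) hi]; push_cast
      rw [show (i : ℝ) + 1 - (i + 2) = -1 by ring]; norm_num
  set S : ℕ → ℝ := fun i => Real.cosh (k * dist (γ (i * δ)) (γ' (i * δ))) - 1 with hS
  have hSnn : ∀ i, 0 ≤ S i := fun i => by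
    have := Real.one_le_cosh (k * dist (γ (i * δ)) (γ' (i * δ))); simp only [hS]; linarith
  have hC : 1 < Real.cosh (k * δ) := Real.one_lt_cosh.2 (by positivity)
  -- comparison with the exact solution `exp (k (r - R))`
  have comp : S (m * n) - S N * Real.exp (k * ((m * n : ℕ) * δ - R)) ≤ 0 := by
    refine nonpos_of_subsolution (f := fun i => S i - S N * Real.exp (k * (i * δ - R)))
      (c := Real.cosh (k * δ)) (N := N) hC ?_ ?_ ?_ (i := m * n) (by rw [hN]; gcongr; omega)
    · simp only [hS, Nat.cast_zero, zero_mul, h.1, h'.1, dist_self, mul_zero, Real.cosh_zero,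
        sub_self, zero_sub]
      have := mul_nonneg (hSnn N) (Real.exp_pos (k * -R)).le
      simp only [hS] at this
      linarith
    · rw [hNδ, sub_self, mul_zero, Real.exp_zero]; simp
    · intro i hi
      obtain ⟨m1, e1⟩ := mids h hx i hi
      obtain ⟨m2, e2⟩ := mids h' hx' i hi
      have p0 := par i (by omega)
      have p1 := par (i + 1) (by omega)
      have p2 := par (i + 2) hi
      have step := hcat.cosh_mul_le hk hgeod m1 m2 e1 e2
        (by
          have := dist_triangle b (γ (i * δ)) (γ' ((i + 2 : ℕ) * δ))
          rw [dl _ p0, dl' _ p2] at this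
          push_cast at this ⊢
          linarith)
        (by
          have := dist_triangle b (γ' (i * δ)) (γ ((i + 2 : ℕ) * δ))
          rw [dl' _ p0, dl _ p2, dist_comm] at this
          push_cast at this ⊢
          linarith)
        (hWδ _ p0) (hWδ _ p2) hδε (hball _ p0) (hball _ p2) (hball' _ p0) (hball' _ p1)
      have ex : Real.cosh (k * δ) * Real.exp (k * ((i + 1 : ℕ) * δ - R)) =
          (Real.exp (k * (i * δ - R)) + Real.exp (k * ((i + 2 : ℕ) * δ - R))) / 2 := by
        rw [Real.cosh_eq, div_mul_eq_mul_div, add_mul, ← Real.exp_add, ← Real.exp_add, add_comm]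
        push_cast
        congr 3 <;> ring
      change Real.cosh (k * δ) * S (i + 1) ≤ (S i + S (i + 2)) / 2 at step
      rw [mul_sub, mul_left_comm, ex]
      linarith
  set w := dist (γ (m * a)) (γ' (m * a)) with hw
  have hSm : S (m * n) = Real.cosh (k * w) - 1 := by simp only [hS]; rw [hmδ]
  have hSN : S N = Real.cosh (k * W) - 1 := by simp only [hS]; rw [hNδ]
  have hexp : Real.exp (k * ((m * n : ℕ) * δ - R)) = Real.exp (-(k * a / 2)) ^ 2 := by
    rw [hmδ, hR, ← Real.exp_nat_mul]; congr 1; push_cast; ring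
  rw [hSm, hSN, hexp] at comp
  have hw0 : 0 ≤ w := dist_nonneg
  have hW0 : 0 ≤ W := dist_nonneg
  have l1 := sq_half_le_cosh_sub_one (x := k * w) (by positivity)
  have l2 := cosh_sub_one_le_sq (x := k * W) (by positivity) (by
    have := hη.trans (min_le_right _ _)
    rw [le_div_iff₀ hk] at this; linarith)
  set E := Real.exp (-(k * a / 2)) with hE
  have hE0 : 0 < E := Real.exp_pos _
  have l3 : (k * w) ^ 2 / 2 ≤ (k * W) ^ 2 * E ^ 2 := by
    have := mul_le_mul_of_nonneg_right l2 (sq_nonneg E)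
    linarith
  have l4 : w ^ 2 ≤ (2 * E * W) ^ 2 := by
    have hk2 : 0 < k ^ 2 := by positivity
    apply le_of_mul_le_mul_left _ hk2
    nlinarith [sq_nonneg (k * W * E)]
  exact le_of_sq_le_sq l4 (by positivity)

/-- Geodesics from `b` to two points, compared at equal distances from `b`. -/
theorem HasConvexMetric.dist_equidistant_le (hconv : HasConvexMetric Y) {γ γ' : ℝ → Y}
    {b x x' : Y} (h : IsGeodesicSegment γ b x) (h' : IsGeodesicSegment γ' b x') {r : ℝ}
    (hr0 : 0 ≤ r) (hr : r ≤ dist b x) (hr' : r ≤ dist b x') :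
    dist (γ r) (γ' r) ≤ 2 * (r / dist b x) * dist x x' := by
  rcases (dist_nonneg (x := b) (y := x)).eq_or_lt with h0 | h0
  · have : r = 0 := by linarith
    subst this
    rw [h.1, h'.1]; simp
  have ht : r / dist b x ∈ Icc (0 : ℝ) 1 := ⟨by positivity, div_le_one_of_le₀ hr h0.le⟩
  have h1 := hconv h h' _ ht
  rw [mul_div_cancel₀ _ h0.ne', dist_self, mul_zero, zero_add] at h1
  have hm : dist b x' * (r / dist b x) ∈ Icc 0 (dist b x') :=
    ⟨mul_nonneg dist_nonneg ht.1, mul_le_of_le_one_right dist_nonneg ht.2⟩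
  have h2 := h'.2.2 _ hm r ⟨hr0, hr'⟩
  have h3 : dist b x' * (r / dist b x) - r = (dist b x' - dist b x) * (r / dist b x) := by
    field_simp
  rw [h3, abs_mul, abs_of_nonneg ht.1] at h2
  have h4 : |dist b x' - dist b x| ≤ dist x x' := by
    have := abs_dist_sub_le x' x b
    rwa [dist_comm x' b, dist_comm x b, dist_comm x' x] at this
  have h5 := mul_le_mul_of_nonneg_right h4 ht.1
  linarith [dist_triangle (γ r) (γ' (dist b x' * (r / dist b x))) (γ' r)]

theorem HasConvexMetric.segment_unique (hconv : HasConvexMetric Y) {γ γ' : ℝ → Y} {b x : Y}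
    (h : IsGeodesicSegment γ b x) (h' : IsGeodesicSegment γ' b x) {r : ℝ}
    (hr : r ∈ Icc 0 (dist b x)) : γ r = γ' r := by
  have := hconv.dist_equidistant_le h h' hr.1 hr.2 hr.2
  rw [dist_self, mul_zero] at this
  exact dist_le_zero.1 this

/-- Exponential contraction towards `b` of geodesics issuing from `b`. The geodesic `[x, y]` is
cut into small pieces, which gives a fan of thin triangles with apex `b`. -/
theorem dist_le_exp_mul_dist (hgeod : IsGeodesicMetricSpace Y) [ProperSpace Y] {k : ℝ}
    (hk : 0 < k) (hloc : ∀ K : Set Y, IsCompact K → ∃ ε > 0, ε ≤ 1 ∧ MidpointCAT k ε K)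
    (hconv : HasConvexMetric Y) {b x y : Y} {a : ℝ} (ha : 0 < a) (m : ℕ) {γ γ' : ℝ → Y}
    (h : IsGeodesicSegment γ b x) (h' : IsGeodesicSegment γ' b y)
    (hx : (m + 1) * a + dist x y ≤ dist b x) :
    dist (γ (m * a)) (γ' (m * a)) ≤ 4 * Real.exp (-(k * a / 2)) * dist x y := by
  obtain ⟨η, hη, thin⟩ := exists_thin_contraction hgeod hk hloc hconv b ha m
  obtain ⟨σ, hσ⟩ := hgeod x y
  choose Γ hΓ using fun z => hgeod b z
  set D := dist x y with hD
  have hD0 : 0 ≤ D := dist_nonneg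
  obtain ⟨n, hn⟩ := exists_nat_gt (2 * D / η)
  have hnpos : (0 : ℝ) < n := lt_of_le_of_lt (by positivity) hn
  have hnη : 2 * (D / n) ≤ η := by
    rw [div_lt_iff₀ hη] at hn
    rw [← mul_div_assoc, div_le_iff₀ hnpos]; linarith
  set p : ℕ → Y := fun j => σ (j * (D / n)) with hp
  have par : ∀ j ≤ n, (j : ℝ) * (D / n) ∈ Icc 0 D := fun j hj => by
    refine ⟨by positivity, ?_⟩
    rw [← mul_div_assoc, div_le_iff₀ hnpos, mul_comm]
    gcongr
  have hR0 : (0 : ℝ) < (m + 1) * a := by positivity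
  have hm0 : (0 : ℝ) ≤ m * a := by positivity
  have hmR : (m : ℝ) * a ≤ (m + 1) * a := by linarith
  have far : ∀ j ≤ n, (m + 1) * a ≤ dist b (p j) := fun j hj => by
    have h1 := hσ.dist_left (par j hj)
    have h2 := dist_triangle_right b x (p j)
    simp only [hp] at h2 ⊢
    linarith [(par j hj).2]
  have stepD : ∀ j < n, dist (p j) (p (j + 1)) = D / n := fun j hj => by
    simp only [hp]
    rw [hσ.2.2 _ (par j hj.le) _ (par (j + 1) hj), ← sub_mul, abs_mul,
      abs_of_nonneg (show (0 : ℝ) ≤ D / n by positivity)]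
    push_cast
    simp
  -- the endpoints `p j`, `p (j + 1)` are not equidistant from `b`, which costs a factor `2`
  have piece : ∀ j < n, dist (Γ (p j) (m * a)) (Γ (p (j + 1)) (m * a)) ≤
      2 * Real.exp (-(k * a / 2)) * (2 * (D / n)) := by
    intro j hj
    have f0 := far j hj.le
    have f1 := far (j + 1) hj
    have h1 := hconv.dist_equidistant_le (hΓ (p j)) (hΓ (p (j + 1))) hR0.le f0 f1
    have h2 : 2 * ((m + 1) * a / dist b (p j)) * dist (p j) (p (j + 1)) ≤ 2 * 1 * (D / n) := by
      rw [stepD j hj]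
      gcongr
      exact div_le_one_of_le₀ f0 dist_nonneg
    have h3 := h1.trans h2
    rw [mul_one] at h3
    refine (thin _ _ _ _ (hΓ _) (hΓ _) f0 f1 (h3.trans hnη)).trans ?_
    gcongr
  have e0 : p 0 = x := by simp only [hp, Nat.cast_zero, zero_mul]; exact hσ.1
  have en : p n = y := by
    simp only [hp]; rw [mul_div_cancel₀ _ hnpos.ne']; exact hσ.2.1
  have F0 := far 0 (Nat.zero_le _)
  have Fn := far n le_rfl
  have g0 := hΓ (p 0)
  have gn := hΓ (p n)
  have sum := dist_le_range_sum_dist (fun j => Γ (p j) (m * a)) n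
  have sum2 := sum.trans (Finset.sum_le_sum fun j hj => piece j (Finset.mem_range.1 hj))
  rw [Finset.sum_const, Finset.card_range, nsmul_eq_mul] at sum2
  rw [e0] at F0 g0 sum2
  rw [en] at Fn gn sum2
  rw [hconv.segment_unique h g0 ⟨hm0, hmR.trans F0⟩, hconv.segment_unique h' gn ⟨hm0, hmR.trans Fn⟩]
  refine sum2.trans (le_of_eq ?_)
  field_simp
  ring

end

/-! ### Asymptotic rays -/

section

variable {Y : Type*} [MetricSpace Y]

theorem IsGeodesicRay.isGeodesicSegment {g : ℝ → Y} (h : IsGeodesicRay g) {T : ℝ} (hT : 0 ≤ T) :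
    IsGeodesicSegment g (g 0) (g T) ∧ dist (g 0) (g T) = T := by
  have e : dist (g 0) (g T) = T := by
    rw [h 0 (self_mem_Ici) T hT, zero_sub, abs_neg, abs_of_nonneg hT]
  refine ⟨⟨rfl, by rw [e], fun s hs t ht => h s hs.1 t ht.1⟩, e⟩

/-- The distance from a point to a ray, normalised by the time, converges: the limit is the value
of the Busemann function of the ray. -/
theorem IsGeodesicRay.exists_tendsto_dist_sub {g : ℝ → Y} (h : IsGeodesicRay g) (y : Y) :
    ∃ c, Tendsto (fun T => dist y (g T) - T) atTop (𝓝 c) := by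
  set f : ℝ → ℝ := fun T => dist y (g (max T 0)) - max T 0 with hf
  have anti : Antitone f := by
    intro S T hST
    have h1 : max S 0 ≤ max T 0 := max_le_max_right 0 hST
    have h2 := h (max S 0) (mem_Ici.2 (le_max_right _ _)) (max T 0) (mem_Ici.2 (le_max_right _ _))
    rw [abs_of_nonpos (by linarith)] at h2
    simp only [hf]
    linarith [dist_triangle y (g (max S 0)) (g (max T 0))]
  have bdd : BddBelow (range f) := by
    refine ⟨-dist (g 0) y, ?_⟩
    rintro _ ⟨T, rfl⟩
    have h2 := h 0 self_mem_Ici (max T 0) (mem_Ici.2 (le_max_right _ _))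
    rw [zero_sub, abs_neg, abs_of_nonneg (le_max_right _ _)] at h2
    simp only [hf]
    linarith [dist_triangle (g 0) y (g (max T 0))]
  refine ⟨_, (tendsto_atTop_ciInf anti bdd).congr' ?_⟩
  filter_upwards [eventually_ge_atTop 0] with T hT
  simp only [hf, max_eq_left hT]

/-- The distance of a ray, at time `t`, from an asymptotic ray with the same horospherical
parametrisation decays exponentially. The geodesics from `g₁ T` back to the origins of the two
rays are compared by `dist_le_exp_mul_dist`, and the second one tends to `g₂` as `T` grows. -/
theorem dist_ray_ray_le (hgeod : IsGeodesicMetricSpace Y) [ProperSpace Y] {k : ℝ}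
    (hk : 0 < k) (hloc : ∀ K : Set Y, IsCompact K → ∃ ε > 0, ε ≤ 1 ∧ MidpointCAT k ε K)
    (hconv : HasConvexMetric Y) {g₁ g₂ : ℝ → Y} (h₁ : IsGeodesicRay g₁) (h₂ : IsGeodesicRay g₂)
    {M : ℝ} (hM : ∀ t ∈ Ici (0 : ℝ), dist (g₁ t) (g₂ t) ≤ M) {c : ℝ}
    (hc : Tendsto (fun T => dist (g₂ 0) (g₁ T) - T) atTop (𝓝 c)) {t : ℝ} (ht : 2 * M < t) :
    dist (g₁ t) (g₂ (t + c)) ≤ 4 * Real.exp (-(k * (t - 2 * M) / 2)) * M := by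
  have hD : dist (g₁ 0) (g₂ 0) ≤ M := hM 0 self_mem_Ici
  have hM0 : 0 ≤ M := dist_nonneg.trans hD
  have ht0 : 0 < t := by linarith
  set L : ℝ → ℝ := fun T => dist (g₂ 0) (g₁ T) with hL
  have L1 : ∀ T, 0 ≤ T → T - M ≤ L T := fun T hT => by
    have := (h₁.isGeodesicSegment hT).2
    simp only [hL]
    linarith [dist_triangle (g₁ 0) (g₂ 0) (g₁ T)]
  have L2 : ∀ T, 0 ≤ T → L T ≤ T + M := fun T hT => by
    have := (h₁.isGeodesicSegment hT).2
    simp only [hL]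
    linarith [dist_triangle_left (g₂ 0) (g₁ T) (g₁ 0)]
  have hcM : -M ≤ c := by
    refine ge_of_tendsto hc ?_
    filter_upwards [eventually_ge_atTop 0] with T hT
    have := L1 T hT
    simp only [hL] at this
    linarith
  set a := t - 2 * M with ha
  have ha0 : 0 < a := by linarith
  have bound : ∀ m : ℕ, dist (g₁ t) (g₂ (t + c)) ≤
      4 * Real.exp (-(k * a / 2)) * M + 2 * M * (t + M) / (t + m * a - M) +
        |L (t + m * a) - (t + m * a) - c| := by
    intro m
    have hma : 0 ≤ (m : ℝ) * a := by positivity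
    set T := t + m * a with hT
    have hT0 : 0 ≤ T := by linarith
    obtain ⟨s₁, d₁⟩ := h₁.isGeodesicSegment hT0
    obtain ⟨s₂, d₂⟩ := h₂.isGeodesicSegment hT0
    obtain ⟨η, hη⟩ := hgeod (g₂ 0) (g₁ T)
    have LT1 := L1 T hT0
    have LT2 := L2 T hT0
    have hLpos : 0 < L T := by linarith
    have fan := dist_le_exp_mul_dist hgeod hk hloc hconv ha0 m s₁.reverse hη.reverse (by
      rw [dist_comm (g₁ T), d₁]; linarith)
    simp only [d₁] at fan
    change dist (g₁ (T - m * a)) (η (L T - m * a)) ≤ _ at fan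
    rw [show T - m * a = t by rw [hT]; ring] at fan
    set s := L T - m * a with hs
    have hs0 : 0 ≤ s := by linarith
    have hsL : s ≤ L T := by linarith
    have hst : s ≤ t + M := by linarith
    have near := hconv hη s₂ (s / L T) ⟨by positivity, div_le_one_of_le₀ hsL hLpos.le⟩
    rw [dist_self, mul_zero, zero_add, d₂] at near
    change dist (η (L T * (s / L T))) _ ≤ _ at near
    rw [mul_div_cancel₀ _ hLpos.ne'] at near
    have near1 : s / L T * dist (g₁ T) (g₂ T) ≤ s / L T * M := by
      gcongr; exact hM T hT0
    have near2 : dist (g₂ (T * (s / L T))) (g₂ s) ≤ s / L T * M := by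
      rw [h₂ _ (show 0 ≤ T * (s / L T) by positivity) _ hs0,
        show T * (s / L T) - s = s / L T * (T - L T) by field_simp, abs_mul,
        abs_of_nonneg (by positivity)]
      gcongr
      exact abs_le.2 ⟨by linarith, by linarith⟩
    have near3 : dist (g₂ s) (g₂ (t + c)) = |L T - T - c| := by
      rw [h₂ _ hs0 _ (show 0 ≤ t + c by linarith)]
      congr 1
      rw [hs, hT]; ring
    have near4 : s / L T * M ≤ (t + M) / (T - M) * M := by
      have : 0 < T - M := by linarith
      gcongr
    have e : 2 * M * (t + M) / (T - M) = 2 * ((t + M) / (T - M) * M) := by ring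
    have fan2 : 4 * Real.exp (-(k * a / 2)) * dist (g₁ 0) (g₂ 0) ≤
        4 * Real.exp (-(k * a / 2)) * M := by gcongr
    rw [e]
    linarith [dist_triangle (g₁ t) (η s) (g₂ (t + c)), dist_triangle (η s) (g₂ s) (g₂ (t + c)),
      dist_triangle (η s) (g₂ (T * (s / L T))) (g₂ s)]
  have hTlim : Tendsto (fun m : ℕ => t + m * a) atTop atTop :=
    tendsto_atTop_add_const_left _ _ (tendsto_natCast_atTop_atTop.atTop_mul_const ha0)
  have l1 : Tendsto (fun m : ℕ => 2 * M * (t + M) / (t + m * a - M)) atTop (𝓝 0) :=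
    (tendsto_atTop_add_const_right _ (-M) hTlim).const_div_atTop _
  have l2 : Tendsto (fun m : ℕ => |L (t + m * a) - (t + m * a) - c|) atTop (𝓝 0) := by
    have := ((hc.comp hTlim).sub_const c).abs
    simpa using this
  have lim := (tendsto_const_nhds (x := 4 * Real.exp (-(k * a / 2)) * M)).add l1 |>.add l2
  rw [add_zero, add_zero] at lim
  exact ge_of_tendsto' lim bound

theorem exists_tendsto_dist_ray_ray (hgeod : IsGeodesicMetricSpace Y) [ProperSpace Y] {k : ℝ}
    (hk : 0 < k) (hloc : ∀ K : Set Y, IsCompact K → ∃ ε > 0, ε ≤ 1 ∧ MidpointCAT k ε K)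
    (hconv : HasConvexMetric Y) {g₁ g₂ : ℝ → Y} (h₁ : IsGeodesicRay g₁) (h₂ : IsGeodesicRay g₂)
    (h : Asymptotic g₁ g₂) :
    ∃ c : ℝ, Tendsto (fun t : ℝ => dist (g₁ t) (g₂ (t + c))) atTop (𝓝 0) := by
  obtain ⟨M, hM⟩ := h
  obtain ⟨c, hc⟩ := h₁.exists_tendsto_dist_sub (g₂ 0)
  refine ⟨c, ?_⟩
  have lim : Tendsto (fun t => 4 * Real.exp (-(k * (t - 2 * M) / 2)) * M) atTop (𝓝 0) := by
    have h1 : Tendsto (fun t => k * (t - 2 * M) / 2) atTop atTop :=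
      ((tendsto_atTop_add_const_right _ (-(2 * M)) tendsto_id).const_mul_atTop hk).atTop_div_const
        two_pos
    simpa using ((Real.tendsto_exp_neg_atTop_nhds_zero.comp h1).const_mul 4).mul_const M
  refine squeeze_zero' (Eventually.of_forall fun _ => dist_nonneg) ?_ lim
  filter_upwards [eventually_gt_atTop (2 * M)] with t ht
  exact dist_ray_ray_le hgeod hk hloc hconv h₁ h₂ hM hc ht

theorem isGeodesicRay_of_isometry {g : ℝ → Y} (h : Isometry g) : IsGeodesicRay g :=
  fun s _ t _ => by rw [h.dist_eq, Real.dist_eq]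

end

end GeodesicSpaces

theorem mainTheorem8 {Y : Type*} [MetricSpace Y] [SimplyConnectedSpace Y] [LocallyCompactSpace Y]
    [CompleteSpace Y] (hgeod : GeodesicSpaces.IsGeodesicMetricSpace Y) (χ : ℝ) (hχ : χ < 0)
    (hcurv : GeodesicSpaces.CurvatureLE Y χ) : GeodesicSpaces.HasConvergentGeodesics Y := by
  have : ProperSpace Y := hgeod.properSpace
  have hk : 0 < √(-χ) := Real.sqrt_pos.2 (by linarith)
  have hloc := fun (K : Set Y) (hK : IsCompact K) =>
    GeodesicSpaces.exists_midpointCAT hgeod hχ hcurv hK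
  have hconv := GeodesicSpaces.hasConvexMetric hgeod hk hloc
  exact ⟨fun g₁ g₂ h₁ h₂ h =>
      GeodesicSpaces.exists_tendsto_dist_ray_ray hgeod hk hloc hconv h₁ h₂ h,
    fun g₁ g₂ h₁ h₂ h => GeodesicSpaces.exists_tendsto_dist_ray_ray hgeod hk hloc hconv
      (GeodesicSpaces.isGeodesicRay_of_isometry h₁) (GeodesicSpaces.isGeodesicRay_of_isometry h₂) h⟩
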